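/- **Theorem 3.5.** For $b>0$ and $a\in\mathbb{R}$ let $\mathrm{AL}(0,a,b)$ denote the asymmetric Laplace distribution, with density $$x\mapsto \frac{1}{\sqrt{2b^2+a^2}}\exp\Big(\frac{a}{b^2}x-\frac1b\sqrt{2+\frac{a^2}{b^2}}\,|x|\Big),\qquad x\in\mathbb{R}.$$ For a class $\mathcal{H}$ of functions $\mathbb{R}\to\mathbb{R}$ put $d_{\mathcal{H}}(X,Y)=\sup_{h\in\mathcal{H}}|\mathbb{E}[h(X)]-\mathbb{E}[h(Y)]|$, and let $d_{\mathrm K}$, $d_{\mathrm W}$ and $d_2$ be the distances obtained when $\mathcal{H}$ is, respectively, the class of indicators of the half-lines $(-\infty,z]$, $z\in\mathbb{R}$; the class of Lipschitz functions with Lipschitz constant at most $1$; and the class of differentiable functions whose derivative is Lipschitz with constant at most $1$. Let $W$ be a real random variable with mean $a\in\mathbb{R}$ and variance $\sigma^2\in(0,\infty)$ such that $\sigma^2>a^2$. Let $W^A$ be a random variable, defined on the same probability space, that has the $W$-asymmetric equilibrium distribution, that is, $$\frac{\sigma^2-a^2}{2}\,\mathbb{E}[f''(W^A)]=\mathbb{E}[f(W)-f(0)-af'(W)]$$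 for all $f:\mathbb{R}\to\mathbb{R}$ for which $f$ and $f'$ are locally absolutely continuous with $\mathbb{E}|f(W)|<\infty$, $\mathbb{E}|f'(W)|<\infty$ and $\mathbb{E}|f''(W^A)|<\infty$ (where $f''$ is the derivative of $f'$ wherever that exists, and $0$ elsewhere). Let $Z\sim\mathrm{AL}(0,a,\sqrt{\sigma^2-a^2})$. (i) For every $\beta>0$, $$d_{\mathrm K}(W,Z)\le\Big(\frac{14}{\sqrt{2\sigma^2-a^2}}+\frac{7|a|}{\sigma^2-a^2}\Big)\beta+\Big(5+\frac{7|a|}{\sqrt{2\sigma^2-a^2}}\Big)\mathbb{P}(|W-W^A|>\beta),$$ $$d_{\mathrm K}(W^A,Z)\le\Big(\frac{2}{\sqrt{2\sigma^2-a^2}}+\frac{4|a|}{\sigma^2-a^2}\Big)\beta+\Big(2+\frac{4|a|}{\sqrt{2\sigma^2-a^2}}\Big)\mathbb{P}(|W-W^A|>\beta).$$ If moreover $\mathbb{E}[|W|^{k+2}]<\infty$ for some real $k\ge1$, then $$d_{\mathrm K}(W,Z)\le\Big(\frac{14}{\sqrt{2\sigma^2-a^2}}+\frac{7|a|}{\sigma^2-a^2}\Big)^{\frac{k}{k+1}}\Big\{(k+k^{-k})\Big(5+\frac{7|a|}{\sqrt{2\sigma^2-a^2}}\Big)\mathbb{E}\big[|W-W^A|^k\big]\Big\}^{\frac1{k+1}}.$$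 (ii) If $\mathbb{E}[|W|^3]<\infty$, then $$d_{\mathrm W}(W,Z)\le2\,\mathbb{E}|W-W^A|,$$ $$d_{\mathrm W}(W^A,Z)\le\Big(1+\frac{2}{\sqrt{2\sigma^2-a^2}}\Big)\mathbb{E}|W-W^A|\quad\text{and}\quad d_{\mathrm W}(W^A,Z)\le\Big(1+\frac{2|a|}{\sqrt{2\sigma^2-a^2}}\Big)\mathbb{E}|W-W^A|,$$ $$d_{\mathrm K}(W^A,Z)\le\Big(\frac{2}{\sqrt{2\sigma^2-a^2}}+\frac{4|a|}{\sigma^2-a^2}\Big)\mathbb{E}|W-W^A|.$$ (iii) If $\mathbb{E}[W^4]<\infty$, then $$d_2(W,Z)\le\frac{\sigma^2-a^2}{\sqrt{2\sigma^2-a^2}}\,\mathbb{E}\big[|\mathbb{E}[W-W^A\mid W]|\big]+\mathbb{E}\big[(W-W^A)^2\big].$$ -/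

import Mathlib

open MeasureTheory ProbabilityTheory
open scoped ENNReal

noncomputable section

namespace AsymLaplace

/-- Integral probability metric between two laws on `ℝ` induced by a class `H` of test functions:
`sup_{h ∈ H} |E h(X) - E h(Y)|` for `X ∼ μ`, `Y ∼ ν`, with values in `[0, ∞]`. -/
def ipm (H : Set (ℝ → ℝ)) (μ ν : Measure ℝ) : ℝ≥0∞ :=
  ⨆ h ∈ H, ENNReal.ofReal |(∫ x, h x ∂μ) - ∫ x, h x ∂ν|

/-- Test functions of the Kolmogorov distance: indicators of the half-lines `(-∞, z]`. -/
def kolmogorovClass : Set (ℝ → ℝ) :=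
  {h | ∃ z : ℝ, h = (Set.Iic z).indicator (fun _ => (1 : ℝ))}

/-- Test functions of the Wasserstein distance: Lipschitz functions with constant at most one. -/
def wassersteinClass : Set (ℝ → ℝ) :=
  {h | LipschitzWith 1 h}

/-- Test functions of the distance `d₂`: differentiable functions whose derivative is Lipschitz
with constant at most one (equivalently, `‖h''‖ ≤ 1` in the essential supremum norm). -/
def smoothClass : Set (ℝ → ℝ) :=
  {h | Differentiable ℝ h ∧ LipschitzWith 1 (deriv h)}

/-- Kolmogorov distance. -/
def dK (μ ν : Measure ℝ) : ℝ≥0∞ := ipm kolmogorovClass μ ν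

/-- Wasserstein distance. -/
def dW (μ ν : Measure ℝ) : ℝ≥0∞ := ipm wassersteinClass μ ν

/-- The smooth Wasserstein distance `d₂`. -/
def d2 (μ ν : Measure ℝ) : ℝ≥0∞ := ipm smoothClass μ ν

/-- Density of the asymmetric Laplace distribution `AL(m, a, b)`. -/
def alPDF (m a b x : ℝ) : ℝ :=
  1 / √(2 * b ^ 2 + a ^ 2)
    * Real.exp (a / b ^ 2 * (x - m) - 1 / b * √(2 + a ^ 2 / b ^ 2) * |x - m|)

/-- The asymmetric Laplace distribution `AL(m, a, b)`, for `b > 0`. -/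
def asymLaplace (m a b : ℝ) : Measure ℝ :=
  volume.withDensity (fun x => ENNReal.ofReal (alPDF m a b x))

/-- Local absolute continuity on `ℝ`: absolute continuity on every compact interval. -/
def LocallyAC (f : ℝ → ℝ) : Prop :=
  ∀ x y : ℝ, AbsolutelyContinuousOnInterval f x y

/-- `ν` is the asymmetric equilibrium distribution with respect to `μ`: if `W ∼ μ` has mean `a` and
variance `σ²`, and `W^A ∼ ν`, then
`(σ² - a²) / 2 * E[f''(W^A)] = E[f(W) - f(0) - a f'(W)]`
for all `f` such that `f` and `f'` are locally absolutely continuous and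
`E|f(W)|`, `E|f'(W)|`, `E|f''(W^A)|` are finite. (The last condition says that the left-hand side
is meaningful; it does not follow from the other two.)

If `f` and `deriv f` are locally absolutely continuous then `f` is continuously differentiable,
so `deriv f` is the classical derivative; `deriv (deriv f)` is the second derivative where it
exists, which is almost everywhere, and zero elsewhere. -/
def IsAsymEquilibrium (ν μ : Measure ℝ) : Prop :=
  ∀ f : ℝ → ℝ, LocallyAC f → LocallyAC (deriv f) →
    Integrable f μ → Integrable (deriv f) μ → Integrable (deriv (deriv f)) ν →
    (Var[fun x => x; μ] - (∫ x, x ∂μ) ^ 2) / 2 * (∫ x, deriv (deriv f) x ∂ν)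
      = ∫ x, (f x - f 0 - (∫ y, y ∂μ) * deriv f x) ∂μ

end AsymLaplace

end

namespace AsymLaplace

/-! Write `μ`, `ν`, `p` for the laws of W, W^A, Z, and put v = σ² - a², s = √(2σ² - a²). Testing the
equilibrium relation on cosines and sines gives (v/2)t² φ_ν = 1 - (1 - iat) φ_μ, while φ_p = 1/(1 -
iat + vt²/2). The function (1 - iat) φ_p is itself the characteristic function of a probability law
`q`, a two-sided exponential (`smoothingKernel`). Eliminating φ_μ yields the exact identity ν + μ ∗
q = p + ν ∗ q (`add_conv_eq_add_conv`).

Integrating h against it, with Qh(x) = ∫ h(x + y) dq(y), gives E h(W^A) - E h(Z) = E[Qh(W^A) -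
Qh(W)] (`integral_comp_sub_integral_eq`). This takes the place of a Stein equation: every bound
reduces to the regularity of Qh.

For Kolmogorov, Qh is a reflected distribution function of `q`, Lipschitz with constant the supremum
of the density of `q`, at most 1/s + 2|a|/v; passing from W^A to W costs one window of width β under
Z and one more exceptional probability. Markov's inequality and a choice of β give the moment bound.
For Wasserstein, Qh inherits the Lipschitz constant 1 of h. For d₂, Taylor expansion at W of both h
and Qh leaves the linear term (W - W^A)(h' - Qh')(W), where |h' - Qh'| ≤ ∫|y| dq = v/s, and two
remainders of at most (W - W^A)²/2 each.

The resulting constants are at least as good as those claimed. Moments of W^A come from those of W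
by testing on double antiderivatives of truncated powers. -/

/-- Two-sided exponential density, `c₁ exp (-l₁ x)` for `x > 0` and `c₂ exp (l₂ x)` for `x ≤ 0`. -/
noncomputable def biexpPDF (c₁ c₂ l₁ l₂ x : ℝ) : ℝ :=
  if 0 < x then c₁ * Real.exp (-l₁ * x) else c₂ * Real.exp (l₂ * x)

/-- The measure with two-sided exponential density. -/
noncomputable def biexp (c₁ c₂ l₁ l₂ : ℝ) : Measure ℝ :=
  volume.withDensity (fun x => ENNReal.ofReal (biexpPDF c₁ c₂ l₁ l₂ x))

/-! ### Two-sided exponential laws: characteristic function, moments, density bound -/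

section Biexp

variable {c₁ c₂ l₁ l₂ : ℝ}

lemma measurable_biexpPDF : Measurable (biexpPDF c₁ c₂ l₁ l₂) := by
  unfold biexpPDF
  exact Measurable.ite measurableSet_Ioi (by fun_prop) (by fun_prop)

lemma biexpPDF_nonneg (hc₁ : 0 ≤ c₁) (hc₂ : 0 ≤ c₂) (x : ℝ) : 0 ≤ biexpPDF c₁ c₂ l₁ l₂ x := by
  unfold biexpPDF
  split_ifs <;> positivity

lemma biexpPDF_le (hc₁ : 0 ≤ c₁) (hc₂ : 0 ≤ c₂) (hl₁ : 0 < l₁) (hl₂ : 0 < l₂) {C : ℝ}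
    (h₁ : c₁ ≤ C) (h₂ : c₂ ≤ C) (x : ℝ) : biexpPDF c₁ c₂ l₁ l₂ x ≤ C := by
  unfold biexpPDF
  split_ifs with hx
  · have : Real.exp (-l₁ * x) ≤ 1 := Real.exp_le_one_iff.2 (by nlinarith)
    nlinarith
  · have : Real.exp (l₂ * x) ≤ 1 := Real.exp_le_one_iff.2 (by nlinarith)
    nlinarith

/-- Values in a general normed space let one formula serve both the complex characteristic function
and the real moments. -/
lemma integrable_biexp_and_integral {E : Type*} [NormedAddCommGroup E] [NormedSpace ℝ E]
    (hc₁ : 0 ≤ c₁) (hc₂ : 0 ≤ c₂) {f : ℝ → E}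
    (h₁ : IntegrableOn (fun x => Real.exp (-l₁ * x) • f x) (Set.Ioi 0))
    (h₂ : IntegrableOn (fun x => Real.exp (l₂ * x) • f x) (Set.Iic 0)) :
    Integrable f (biexp c₁ c₂ l₁ l₂) ∧
      ∫ x, f x ∂(biexp c₁ c₂ l₁ l₂) = c₁ • (∫ x in Set.Ioi 0, Real.exp (-l₁ * x) • f x)
        + c₂ • ∫ x in Set.Iic 0, Real.exp (l₂ * x) • f x := by
  have hm : Measurable fun x => ENNReal.ofReal (biexpPDF c₁ c₂ l₁ l₂ x) :=
    measurable_biexpPDF.ennreal_ofReal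
  have hfin : ∀ᵐ x ∂(volume : Measure ℝ), ENNReal.ofReal (biexpPDF c₁ c₂ l₁ l₂ x) < ∞ :=
    Filter.Eventually.of_forall fun x => ENNReal.ofReal_lt_top
  have hd : ∀ x, (ENNReal.ofReal (biexpPDF c₁ c₂ l₁ l₂ x)).toReal = biexpPDF c₁ c₂ l₁ l₂ x :=
    fun x => ENNReal.toReal_ofReal (biexpPDF_nonneg hc₁ hc₂ x)
  have e₁ : Set.EqOn (fun x => c₁ • Real.exp (-l₁ * x) • f x)
      (fun x => biexpPDF c₁ c₂ l₁ l₂ x • f x) (Set.Ioi 0) := by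
    intro x hx
    simp only [biexpPDF, if_pos (Set.mem_Ioi.1 hx), mul_smul]
  have e₂ : Set.EqOn (fun x => c₂ • Real.exp (l₂ * x) • f x)
      (fun x => biexpPDF c₁ c₂ l₁ l₂ x • f x) (Set.Iic 0) := by
    intro x hx
    simp only [biexpPDF, if_neg (not_lt.2 (Set.mem_Iic.1 hx)), mul_smul]
  have i₁ : IntegrableOn (fun x => biexpPDF c₁ c₂ l₁ l₂ x • f x) (Set.Ioi 0) :=
    (integrableOn_congr_fun e₁ measurableSet_Ioi).1 (h₁.smul c₁)
  have i₂ : IntegrableOn (fun x => biexpPDF c₁ c₂ l₁ l₂ x • f x) (Set.Iic 0) :=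
    (integrableOn_congr_fun e₂ measurableSet_Iic).1 (h₂.smul c₂)
  constructor
  · rw [biexp, integrable_withDensity_iff_integrable_smul' hm hfin]
    simp only [hd]
    rw [← integrableOn_univ, ← Set.Iic_union_Ioi (a := (0 : ℝ))]
    exact i₂.union i₁
  · rw [biexp, integral_withDensity_eq_integral_toReal_smul hm hfin]
    simp only [hd]
    rw [← integral_smul, ← integral_smul, setIntegral_congr_fun measurableSet_Ioi e₁,
      setIntegral_congr_fun measurableSet_Iic e₂, add_comm,
      intervalIntegral.integral_Iic_add_Ioi i₂ i₁]

lemma integrableOn_exp_smul_cexp (hl : 0 < l₁) (t : ℝ) :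
    IntegrableOn (fun x : ℝ => Real.exp (-l₁ * x) • Complex.exp (t * x * Complex.I))
      (Set.Ioi 0) ∧
    ∫ x in Set.Ioi (0 : ℝ), Real.exp (-l₁ * x) • Complex.exp (t * x * Complex.I)
      = 1 / (l₁ - t * Complex.I) := by
  have e : (fun x : ℝ => Real.exp (-l₁ * x) • Complex.exp (t * x * Complex.I))
      = fun x : ℝ => Complex.exp ((-l₁ + t * Complex.I) * x) := by
    ext x
    rw [Complex.real_smul, Complex.ofReal_exp, ← Complex.exp_add]
    congr 1
    push_cast
    ring
  have hre : (-l₁ + t * Complex.I : ℂ).re < 0 := by simpa using hl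
  rw [e]
  refine ⟨integrableOn_exp_mul_complex_Ioi hre 0, ?_⟩
  rw [integral_exp_mul_complex_Ioi hre 0]
  simp only [Complex.ofReal_zero, mul_zero, Complex.exp_zero]
  rw [neg_div, ← div_neg]
  congr 1
  ring

lemma integrableOn_Iic_exp_smul_cexp (hl : 0 < l₂) (t : ℝ) :
    IntegrableOn (fun x : ℝ => Real.exp (l₂ * x) • Complex.exp (t * x * Complex.I))
      (Set.Iic 0) ∧
    ∫ x in Set.Iic (0 : ℝ), Real.exp (l₂ * x) • Complex.exp (t * x * Complex.I)
      = 1 / (l₂ + t * Complex.I) := by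
  have e : (fun x : ℝ => Real.exp (l₂ * x) • Complex.exp (t * x * Complex.I))
      = fun x : ℝ => Complex.exp ((l₂ + t * Complex.I) * x) := by
    ext x
    rw [Complex.real_smul, Complex.ofReal_exp, ← Complex.exp_add]
    congr 1
    push_cast
    ring
  have hre : 0 < (l₂ + t * Complex.I : ℂ).re := by simpa using hl
  rw [e]
  refine ⟨integrableOn_exp_mul_complex_Iic hre 0, ?_⟩
  rw [integral_exp_mul_complex_Iic hre 0]
  simp

lemma charFun_biexp (hc₁ : 0 ≤ c₁) (hc₂ : 0 ≤ c₂) (hl₁ : 0 < l₁) (hl₂ : 0 < l₂) (t : ℝ) :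
    charFun (biexp c₁ c₂ l₁ l₂) t
      = c₁ / (l₁ - t * Complex.I) + c₂ / (l₂ + t * Complex.I) := by
  rw [charFun_apply_real]
  rw [(integrable_biexp_and_integral hc₁ hc₂ (integrableOn_exp_smul_cexp hl₁ t).1
    (integrableOn_Iic_exp_smul_cexp hl₂ t).1).2, (integrableOn_exp_smul_cexp hl₁ t).2,
    (integrableOn_Iic_exp_smul_cexp hl₂ t).2, Complex.real_smul, Complex.real_smul]
  ring

lemma isFiniteMeasure_biexp (hc₁ : 0 ≤ c₁) (hc₂ : 0 ≤ c₂) (hl₁ : 0 < l₁) (hl₂ : 0 < l₂) :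
    IsFiniteMeasure (biexp c₁ c₂ l₁ l₂) := by
  have h := (integrable_biexp_and_integral hc₁ hc₂ (integrableOn_exp_smul_cexp hl₁ 0).1
    (integrableOn_Iic_exp_smul_cexp hl₂ 0).1).1
  simp only [Complex.ofReal_zero, zero_mul, Complex.exp_zero] at h
  -- At t = 0 the integrable exponential is the constant 1, which is integrable only for a finite
  -- measure.
  exact (integrable_const_iff_isFiniteMeasure one_ne_zero).1 h

lemma isProbabilityMeasure_biexp (hc₁ : 0 ≤ c₁) (hc₂ : 0 ≤ c₂) (hl₁ : 0 < l₁) (hl₂ : 0 < l₂)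
    (h : c₁ / l₁ + c₂ / l₂ = 1) : IsProbabilityMeasure (biexp c₁ c₂ l₁ l₂) := by
  have := isFiniteMeasure_biexp hc₁ hc₂ hl₁ hl₂
  have h0 := charFun_biexp hc₁ hc₂ hl₁ hl₂ 0
  rw [charFun_zero] at h0
  simp only [Complex.ofReal_zero, zero_mul, sub_zero, add_zero] at h0
  have h1 : (biexp c₁ c₂ l₁ l₂).real Set.univ = 1 := by
    rw [← h]
    exact_mod_cast h0
  refine ⟨?_⟩
  rwa [measureReal_def, ENNReal.toReal_eq_one_iff] at h1

lemma biexp_real_Ioc_le (hc₁ : 0 ≤ c₁) (hc₂ : 0 ≤ c₂) (hl₁ : 0 < l₁) (hl₂ : 0 < l₂) {C : ℝ}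
    (h₁ : c₁ ≤ C) (h₂ : c₂ ≤ C) {x y : ℝ} (hxy : x ≤ y) :
    (biexp c₁ c₂ l₁ l₂).real (Set.Ioc x y) ≤ C * (y - x) := by
  have hC : 0 ≤ C := hc₁.trans h₁
  refine ENNReal.toReal_le_of_le_ofReal (mul_nonneg hC (sub_nonneg.2 hxy)) ?_
  rw [biexp, withDensity_apply _ measurableSet_Ioc, ENNReal.ofReal_mul hC, ← Real.volume_Ioc,
    ← setLIntegral_const]
  exact lintegral_mono fun u =>
    ENNReal.ofReal_le_ofReal (biexpPDF_le hc₁ hc₂ hl₁ hl₂ h₁ h₂ u)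

lemma integrableOn_exp_mul_pow (hl : 0 < l₁) (n : ℕ) :
    IntegrableOn (fun x : ℝ => Real.exp (-l₁ * x) * x ^ n) (Set.Ioi 0) ∧
    ∫ x in Set.Ioi (0 : ℝ), Real.exp (-l₁ * x) * x ^ n = n.factorial / l₁ ^ (n + 1) := by
  have h0 : (0 : ℝ) < n + 1 := by positivity
  have key := Real.integral_rpow_mul_exp_neg_mul_Ioi h0 hl
  have e : ∀ x : ℝ, x ^ ((n : ℝ) + 1 - 1) * Real.exp (-(l₁ * x)) = Real.exp (-l₁ * x) * x ^ n := by
    intro x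
    rw [add_sub_cancel_right, Real.rpow_natCast, mul_comm, neg_mul]
  simp only [e] at key
  rw [Real.Gamma_nat_eq_factorial] at key
  have key' : ∫ x in Set.Ioi (0 : ℝ), Real.exp (-l₁ * x) * x ^ n
      = n.factorial / l₁ ^ (n + 1) := by
    rw [key]
    have : (1 / l₁) ^ ((n : ℝ) + 1) = (1 / l₁) ^ (n + 1) := by
      exact_mod_cast Real.rpow_natCast (1 / l₁) (n + 1)
    rw [this, one_div, inv_pow]
    ring
  refine ⟨?_, key'⟩
  -- A non-integrable function has integral 0 by convention, so the positive value just computed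
  -- forces integrability.
  by_contra hn
  have h1 := integral_undef hn
  rw [key'] at h1
  have : (0 : ℝ) < n.factorial / l₁ ^ (n + 1) := by positivity
  linarith

lemma integrableOn_Iic_exp_mul_pow (hl : 0 < l₂) (n : ℕ) :
    IntegrableOn (fun x : ℝ => Real.exp (l₂ * x) * (-x) ^ n) (Set.Iic 0) ∧
    ∫ x in Set.Iic (0 : ℝ), Real.exp (l₂ * x) * (-x) ^ n = n.factorial / l₂ ^ (n + 1) := by
  have h := integrableOn_exp_mul_pow hl n
  have e : (fun x : ℝ => Real.exp (l₂ * x) * (-x) ^ n)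
      = fun x => (fun u : ℝ => Real.exp (-l₂ * u) * u ^ n) (-x) := by
    ext x
    simp
  constructor
  · rw [e, integrableOn_Iic_iff_integrableOn_Iio]
    refine IntegrableOn.comp_neg_Iio (f := fun u : ℝ => Real.exp (-l₂ * u) * u ^ n) ?_
    simpa using h.1
  · rw [e]
    exact (integral_comp_neg_Iic 0 fun u : ℝ => Real.exp (-l₂ * u) * u ^ n).trans
      (by rw [neg_zero, h.2])

lemma integrable_biexp_abs_pow (hc₁ : 0 ≤ c₁) (hc₂ : 0 ≤ c₂) (hl₁ : 0 < l₁) (hl₂ : 0 < l₂)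
    (n : ℕ) : Integrable (fun x => |x| ^ n) (biexp c₁ c₂ l₁ l₂) ∧
      ∫ x, |x| ^ n ∂(biexp c₁ c₂ l₁ l₂)
        = n.factorial * (c₁ / l₁ ^ (n + 1) + c₂ / l₂ ^ (n + 1)) := by
  have e₁ : Set.EqOn (fun x : ℝ => Real.exp (-l₁ * x) * x ^ n)
      (fun x => Real.exp (-l₁ * x) • |x| ^ n) (Set.Ioi 0) := by
    intro x hx
    simp only [smul_eq_mul, abs_of_pos (Set.mem_Ioi.1 hx)]
  have e₂ : Set.EqOn (fun x : ℝ => Real.exp (l₂ * x) * (-x) ^ n)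
      (fun x => Real.exp (l₂ * x) • |x| ^ n) (Set.Iic 0) := by
    intro x hx
    simp only [smul_eq_mul, abs_of_nonpos (Set.mem_Iic.1 hx)]
  have h₁ := integrableOn_exp_mul_pow hl₁ n
  have h₂ := integrableOn_Iic_exp_mul_pow hl₂ n
  rw [integrableOn_congr_fun e₁ measurableSet_Ioi, setIntegral_congr_fun measurableSet_Ioi e₁]
    at h₁
  rw [integrableOn_congr_fun e₂ measurableSet_Iic, setIntegral_congr_fun measurableSet_Iic e₂]
    at h₂
  have h := integrable_biexp_and_integral hc₁ hc₂ h₁.1 h₂.1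
  refine ⟨h.1, ?_⟩
  rw [h.2, h₁.2, h₂.2, smul_eq_mul, smul_eq_mul]
  ring

lemma memLp_id_biexp (hc₁ : 0 ≤ c₁) (hc₂ : 0 ≤ c₂) (hl₁ : 0 < l₁) (hl₂ : 0 < l₂) :
    MemLp id 2 (biexp c₁ c₂ l₁ l₂) := by
  rw [memLp_two_iff_integrable_sq (by fun_prop)]
  simpa using (integrable_biexp_abs_pow hc₁ hc₂ hl₁ hl₂ 2).1

end Biexp

/-- The asymmetric Laplace law as a two-sided exponential law. -/
lemma asymLaplace_eq_biexp (a : ℝ) {b : ℝ} (hb : 0 < b) :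
    asymLaplace 0 a b = biexp (1 / √(2 * b ^ 2 + a ^ 2)) (1 / √(2 * b ^ 2 + a ^ 2))
      ((√(2 * b ^ 2 + a ^ 2) - a) / b ^ 2) ((√(2 * b ^ 2 + a ^ 2) + a) / b ^ 2) := by
  have hs : 1 / b * √(2 + a ^ 2 / b ^ 2) = √(2 * b ^ 2 + a ^ 2) / b ^ 2 := by
    have : 2 + a ^ 2 / b ^ 2 = (2 * b ^ 2 + a ^ 2) / b ^ 2 := by field_simp
    rw [this, Real.sqrt_div' _ (by positivity), Real.sqrt_sq hb.le]
    field_simp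
  unfold asymLaplace biexp
  congr 1
  ext x
  congr 1
  unfold alPDF biexpPDF
  rw [hs, sub_zero]
  split_ifs with hx
  · rw [abs_of_pos hx]
    congr 2
    ring
  · rw [abs_of_nonpos (not_lt.1 hx)]
    congr 2
    ring

lemma locallyAC_of_contDiff {f : ℝ → ℝ} (hf : ContDiff ℝ 1 f) : LocallyAC f :=
  fun _ _ => hf.contDiffOn.absolutelyContinuousOnInterval

/-! ### Equilibrium relation on the Fourier side and the convolution identity -/

section Equilibrium

variable {μ ν p q : Measure ℝ}

lemma integrable_exp_mul_I [IsFiniteMeasure μ] (t : ℝ) :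
    Integrable (fun x : ℝ => Complex.exp (t * x * Complex.I)) μ := by
  refine (integrable_const (1 : ℝ)).mono' (by fun_prop) (Filter.Eventually.of_forall fun x => ?_)
  exact_mod_cast (Complex.norm_exp_ofReal_mul_I (t * x)).le

lemma integrable_cos_mul [IsFiniteMeasure μ] (t : ℝ) :
    Integrable (fun x : ℝ => Real.cos (t * x)) μ :=
  (integrable_const (1 : ℝ)).mono' (by fun_prop)
    (Filter.Eventually.of_forall fun x => Real.abs_cos_le_one _)

lemma integrable_sin_mul [IsFiniteMeasure μ] (t : ℝ) :
    Integrable (fun x : ℝ => Real.sin (t * x)) μ :=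
  (integrable_const (1 : ℝ)).mono' (by fun_prop)
    (Filter.Eventually.of_forall fun x => Real.abs_sin_le_one _)

lemma charFun_eq_integral_cos_add_integral_sin [IsFiniteMeasure μ] (t : ℝ) :
    charFun μ t = ((∫ x, Real.cos (t * x) ∂μ : ℝ) : ℂ)
      + ((∫ x, Real.sin (t * x) ∂μ : ℝ) : ℂ) * Complex.I := by
  rw [charFun_apply_real, ← integral_complex_ofReal, ← integral_complex_ofReal, ← integral_mul_const,
    ← integral_add (integrable_cos_mul t).ofReal ((integrable_sin_mul t).ofReal.mul_const _)]
  refine integral_congr_ae (Filter.Eventually.of_forall fun x => ?_)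
  simp only [Complex.ofReal_cos, Complex.ofReal_sin, Complex.ofReal_mul]
  rw [Complex.exp_mul_I]

lemma deriv_cos_mul (t : ℝ) :
    deriv (fun x : ℝ => Real.cos (t * x)) = fun x => -t * Real.sin (t * x) := by
  ext x
  have h : HasDerivAt (fun x : ℝ => Real.cos (t * x)) (-Real.sin (t * x) * (t * 1)) x :=
    ((hasDerivAt_id x).const_mul t).cos
  rw [h.deriv]
  ring

lemma deriv_sin_mul (t : ℝ) :
    deriv (fun x : ℝ => Real.sin (t * x)) = fun x => t * Real.cos (t * x) := by
  ext x
  have h : HasDerivAt (fun x : ℝ => Real.sin (t * x)) (Real.cos (t * x) * (t * 1)) x :=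
    ((hasDerivAt_id x).const_mul t).sin
  rw [h.deriv]
  ring

/-- The asymmetric equilibrium relation in terms of characteristic functions. -/
lemma IsAsymEquilibrium.charFun_eq [IsProbabilityMeasure μ] [IsProbabilityMeasure ν]
    (h : IsAsymEquilibrium ν μ) {a v : ℝ} (ha : ∫ x, x ∂μ = a)
    (hv : Var[fun x => x; μ] - a ^ 2 = v) (t : ℝ) :
    (v / 2 * t ^ 2 : ℂ) * charFun ν t = 1 - (1 - a * t * Complex.I) * charFun μ t := by
  -- Only real test functions are admitted, so exp(itx) is tested through its real and imaginary
  -- parts, recombined at the end.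
  have hc := h (fun x => Real.cos (t * x)) (locallyAC_of_contDiff (by fun_prop))
    (by rw [deriv_cos_mul]; exact locallyAC_of_contDiff (by fun_prop)) (integrable_cos_mul t)
    (by rw [deriv_cos_mul]; exact (integrable_sin_mul t).const_mul _)
    (by
      rw [deriv_cos_mul, deriv_const_mul_field', deriv_sin_mul]
      exact ((integrable_cos_mul t).const_mul _).const_mul _)
  have hs := h (fun x => Real.sin (t * x)) (locallyAC_of_contDiff (by fun_prop))
    (by rw [deriv_sin_mul]; exact locallyAC_of_contDiff (by fun_prop)) (integrable_sin_mul t)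
    (by rw [deriv_sin_mul]; exact (integrable_cos_mul t).const_mul _)
    (by
      rw [deriv_sin_mul, deriv_const_mul_field', deriv_cos_mul]
      exact ((integrable_sin_mul t).const_mul _).const_mul _)
  simp only [deriv_cos_mul, deriv_const_mul_field', deriv_sin_mul, ha, hv] at hc
  rw [integral_sub (f := fun x => Real.cos (t * x) - Real.cos (t * 0))
      ((integrable_cos_mul t).sub (integrable_const _))
      (((integrable_sin_mul t).const_mul _).const_mul _),
    integral_sub (integrable_cos_mul t) (integrable_const _)] at hc
  simp only [deriv_cos_mul, deriv_const_mul_field', deriv_sin_mul, ha, hv] at hs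
  rw [integral_sub (f := fun x => Real.sin (t * x) - Real.sin (t * 0))
      ((integrable_sin_mul t).sub (integrable_const _))
      (((integrable_cos_mul t).const_mul _).const_mul _),
    integral_sub (integrable_sin_mul t) (integrable_const _)] at hs
  simp only [integral_const_mul, mul_zero, Real.cos_zero, Real.sin_zero, integral_const,
    probReal_univ, smul_eq_mul, one_mul] at hc hs
  rw [charFun_eq_integral_cos_add_integral_sin, charFun_eq_integral_cos_add_integral_sin]
  have hc' := congrArg (fun x : ℝ => (x : ℂ)) hc
  have hs' := congrArg (fun x : ℝ => (x : ℂ)) hs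
  push_cast at hc' hs'
  linear_combination -hc' - Complex.I * hs'
    - a * t * (∫ x, Real.sin (t * x) ∂μ : ℝ) * Complex.I_sq

/-- The convolution identity linking a law `μ`, its equilibrium law `ν` and the target `p`. -/
lemma add_conv_eq_add_conv [IsProbabilityMeasure μ] [IsProbabilityMeasure ν]
    [IsProbabilityMeasure p] [IsProbabilityMeasure q]
    (h : IsAsymEquilibrium ν μ) {a v : ℝ} (ha : ∫ x, x ∂μ = a)
    (hv : Var[fun x => x; μ] - a ^ 2 = v)
    (hp : ∀ t : ℝ, (1 - a * t * Complex.I + v / 2 * t ^ 2) * charFun p t = 1)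
    (hq : ∀ t : ℝ, charFun q t = (1 - a * t * Complex.I) * charFun p t) :
    ν + μ ∗ q = p + ν ∗ q := by
  refine Measure.ext_of_charFun (funext fun t => ?_)
  have hadd : ∀ (m₁ m₂ : Measure ℝ) [IsFiniteMeasure m₁] [IsFiniteMeasure m₂],
      charFun (m₁ + m₂) t = charFun m₁ t + charFun m₂ t := by
    intro m₁ m₂ _ _
    simp only [charFun_apply_real]
    exact integral_add_measure (integrable_exp_mul_I t) (integrable_exp_mul_I t)
  -- After this, both sides are polynomial in φ_μ, φ_ν, φ_p; `h1` times φ_p removes φ_μ, and `h2`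
  -- times φ_ν removes the rest.
  rw [hadd, hadd, charFun_conv, charFun_conv, hq]
  have h1 := h.charFun_eq ha hv t
  have h2 := hp t
  linear_combination (-charFun ν t) * h2 + charFun p t * h1

end Equilibrium

/-! ### Smoothing by convolution, Taylor estimates, moments of the equilibrium law -/

section Smoothing

variable {μ ν p q : Measure ℝ}

lemma integrable_integral_add [SFinite q] {h : ℝ → ℝ}
    (hh : Integrable h (μ ∗ q)) [SFinite μ] : Integrable (fun x => ∫ y, h (x + y) ∂q) μ := by
  unfold Measure.conv at hh
  exact ((integrable_map_measure hh.1 (by fun_prop)).1 hh).integral_prod_left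

/-- Integrates h against the convolution identity. All four integrals must be finite for the terms
to be moved across. -/
lemma integral_sub_integral_eq [IsProbabilityMeasure μ] [IsProbabilityMeasure ν]
    [IsProbabilityMeasure p] [IsProbabilityMeasure q] (hid : ν + μ ∗ q = p + ν ∗ q)
    {h : ℝ → ℝ} (hν : Integrable h ν) (hp : Integrable h p) (hμq : Integrable h (μ ∗ q))
    (hνq : Integrable h (ν ∗ q)) :
    ∫ x, h x ∂ν - ∫ x, h x ∂p
      = ∫ x, ∫ y, h (x + y) ∂q ∂ν - ∫ x, ∫ y, h (x + y) ∂q ∂μ := by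
  have := congrArg (fun m : Measure ℝ => ∫ x, h x ∂m) hid
  simp only [integral_add_measure hν hμq, integral_add_measure hp hνq,
    integral_conv hμq, integral_conv hνq] at this
  linarith

lemma memLp_id_conv {r : ℝ≥0∞} [IsProbabilityMeasure μ] [IsProbabilityMeasure q]
    (hμ : MemLp id r μ) (hq : MemLp id r q) : MemLp id r (μ ∗ q) := by
  unfold Measure.conv
  rw [memLp_map_measure_iff (by fun_prop) (by fun_prop)]
  exact (hμ.comp_fst q).add (hq.comp_snd μ)

lemma integrable_of_lipschitzWith [IsFiniteMeasure μ] (hμ : MemLp id 1 μ) {K : NNReal}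
    {h : ℝ → ℝ} (hh : LipschitzWith K h) : Integrable h μ := by
  have hi : Integrable (fun x : ℝ => x) μ := memLp_one_iff_integrable.1 hμ
  refine ((integrable_const |h 0|).add (hi.abs.const_mul (K : ℝ))).mono'
    hh.continuous.aestronglyMeasurable (Filter.Eventually.of_forall fun x => ?_)
  have h1 := hh.dist_le_mul x 0
  rw [Real.dist_eq, Real.dist_eq, sub_zero] at h1
  rw [Real.norm_eq_abs]
  have h2 := abs_sub_abs_le_abs_sub (h x) (h 0)
  simp only [Pi.add_apply]
  linarith

lemma lipschitzWith_integral_add [IsProbabilityMeasure q] (hq : MemLp id 1 q) {K : NNReal}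
    {h : ℝ → ℝ} (hh : LipschitzWith K h) : LipschitzWith K (fun x => ∫ y, h (x + y) ∂q) := by
  have hi : ∀ x, Integrable (fun y => h (x + y)) q := fun x =>
    integrable_of_lipschitzWith hq (K := K * 1)
      (hh.comp (LipschitzWith.of_dist_le_mul fun u v => by rw [dist_add_left, NNReal.coe_one, one_mul]))
  refine LipschitzWith.of_dist_le_mul fun x x' => ?_
  rw [Real.dist_eq, ← integral_sub (hi x) (hi x')]
  have hb := norm_integral_le_of_norm_le_const (μ := q) (C := K * dist x x')
    (f := fun y => h (x + y) - h (x' + y)) (Filter.Eventually.of_forall fun y => ?_)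
  · rwa [probReal_univ, mul_one] at hb
  have := hh.dist_le_mul (x + y) (x' + y)
  rwa [dist_add_right] at this

/-- First-order Taylor estimate for a function with `1`-Lipschitz derivative. -/
lemma abs_sub_sub_deriv_mul_le {h : ℝ → ℝ} (hd : Differentiable ℝ h)
    (hl : LipschitzWith 1 (deriv h)) (x y : ℝ) :
    |h y - h x - deriv h x * (y - x)| ≤ (y - x) ^ 2 / 2 := by
  have hcont : Continuous fun s : ℝ => deriv h (x + s * (y - x)) * (y - x) :=
    (hl.continuous.comp (by fun_prop)).mul continuous_const
  have hder : ∀ s ∈ Set.uIcc (0 : ℝ) 1, HasDerivAt (fun s : ℝ => h (x + s * (y - x)))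
      (deriv h (x + s * (y - x)) * (y - x)) s := by
    intro s _
    have h1 : HasDerivAt (fun s : ℝ => x + s * (y - x)) (1 * (y - x)) s :=
      ((hasDerivAt_id s).mul_const (y - x)).const_add x
    rw [one_mul] at h1
    exact (hd (x + s * (y - x))).hasDerivAt.comp s h1
  have hint := intervalIntegral.integral_eq_sub_of_hasDerivAt hder (hcont.intervalIntegrable 0 1)
  have hconst : ∫ _ in (0 : ℝ)..1, deriv h x * (y - x) = deriv h x * (y - x) := by simp
  have e : h y - h x - deriv h x * (y - x)
      = ∫ s in (0 : ℝ)..1, (deriv h (x + s * (y - x)) * (y - x) - deriv h x * (y - x)) := by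
    rw [intervalIntegral.integral_sub (hcont.intervalIntegrable 0 1) intervalIntegrable_const,
      hint, hconst]
    simp
  rw [e, ← Real.norm_eq_abs]
  have hb : ∫ s in (0 : ℝ)..1, s * (y - x) ^ 2 = (y - x) ^ 2 / 2 := by
    rw [intervalIntegral.integral_mul_const, integral_id]
    ring
  rw [← hb]
  refine intervalIntegral.norm_integral_le_of_norm_le zero_le_one
    (Filter.Eventually.of_forall fun s hs => ?_)
    ((by fun_prop : Continuous fun s : ℝ => s * (y - x) ^ 2).intervalIntegrable 0 1)
  have h1 := hl.dist_le_mul (x + s * (y - x)) x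
  rw [Real.dist_eq, Real.dist_eq, add_sub_cancel_left, abs_mul, abs_of_pos hs.1,
    NNReal.coe_one, one_mul] at h1
  rw [← sub_mul, Real.norm_eq_abs, abs_mul]
  calc |deriv h (x + s * (y - x)) - deriv h x| * |y - x|
      ≤ s * |y - x| * |y - x| := mul_le_mul_of_nonneg_right h1 (abs_nonneg _)
    _ = s * (y - x) ^ 2 := by rw [mul_assoc, abs_mul_abs_self]; ring

/-- Taylor's estimate at 0 shows that such h grows at most quadratically. -/
lemma integrable_of_mem_smoothClass [IsFiniteMeasure μ] (hμ : MemLp id 2 μ) {h : ℝ → ℝ}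
    (hh : h ∈ smoothClass) : Integrable h μ := by
  have hi : Integrable (fun x : ℝ => x) μ := hμ.integrable one_le_two
  have hi2 : Integrable (fun x : ℝ => x ^ 2) μ := hμ.integrable_sq
  refine (((integrable_const |h 0|).add (hi.abs.const_mul |deriv h 0|)).add hi2).mono'
    hh.1.continuous.aestronglyMeasurable (Filter.Eventually.of_forall fun x => ?_)
  have h1 := abs_sub_sub_deriv_mul_le hh.1 hh.2 0 x
  rw [sub_zero] at h1
  simp only [Pi.add_apply]
  rw [Real.norm_eq_abs, ← abs_mul]
  have h2 := abs_sub_abs_le_abs_sub (h x) (h 0)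
  have h3 := abs_sub_abs_le_abs_sub (h x - h 0) (deriv h 0 * x)
  have h4 := sq_nonneg x
  linarith

/-- Testing on a function with f'' = |x|^k would give the moment at once, but the relation
presupposes that f'' is integrable under `ν`. So |x|^k is truncated at n, bounded uniformly in n,
and Fatou's lemma removes the truncation. -/
lemma integrable_rpow_of_isAsymEquilibrium [IsProbabilityMeasure μ] [IsProbabilityMeasure ν]
    (h : IsAsymEquilibrium ν μ) (hv : 0 < Var[fun x => x; μ] - (∫ x, x ∂μ) ^ 2) {k : ℝ}
    (hk : 0 ≤ k) (hμ : Integrable (fun x => |x| ^ (k + 2)) μ) :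
    Integrable (fun x => |x| ^ k) ν := by
  have hcp : Continuous fun x : ℝ => |x| ^ k :=
    continuous_abs.rpow_const fun _ => Or.inr hk
  have hpow : ∀ x : ℝ, |x| ^ (k + 2) = |x| ^ k * |x| ^ 2 := fun x => by
    rw [Real.rpow_add_of_nonneg (abs_nonneg x) hk zero_le_two, Real.rpow_two]
  set m := ∫ x, x ∂μ with hm
  set C := ∫ x, (|x| ^ (k + 2) + |m| * (|x| ^ (k + 2) + 1)) ∂μ with hC
  have hCi : Integrable (fun x => |x| ^ (k + 2) + |m| * (|x| ^ (k + 2) + 1)) μ :=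
    hμ.add ((hμ.add (integrable_const 1)).const_mul _)
  have key : ∀ n : ℕ, Integrable (fun x => min (|x| ^ k) (n : ℝ)) ν ∧
      ∫ x, min (|x| ^ k) (n : ℝ) ∂ν ≤ 2 / (Var[fun x => x; μ] - m ^ 2) * C := by
    intro n
    set g : ℝ → ℝ := fun x => min (|x| ^ k) (n : ℝ) with hg
    have hg0 : ∀ x, 0 ≤ g x := fun x => le_min (by positivity) (by positivity)
    have hgc : Continuous g := hcp.min continuous_const
    set F : ℝ → ℝ := fun x => ∫ u in (0 : ℝ)..x, g u with hF
    have hFd : ∀ x, HasDerivAt F (g x) x := fun x => hgc.integral_hasStrictDerivAt 0 x |>.hasDerivAt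
    have hFderiv : deriv F = g := funext fun x => (hFd x).deriv
    have hFC : ContDiff ℝ 1 F := by
      rw [contDiff_one_iff_deriv, hFderiv]
      exact ⟨fun x => (hFd x).differentiableAt, hgc⟩
    -- The double antiderivative from 0 has f(0) = 0 and f'' = g, and |f| ≤ |x|^(k+2) whatever n is.
    set f : ℝ → ℝ := fun x => ∫ u in (0 : ℝ)..x, F u with hf
    have hfd : ∀ x, HasDerivAt f (F x) x := fun x =>
      hFC.continuous.integral_hasStrictDerivAt 0 x |>.hasDerivAt
    have hfderiv : deriv f = F := funext fun x => (hfd x).deriv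
    have hfC : ContDiff ℝ 1 f := by
      rw [contDiff_one_iff_deriv, hfderiv]
      exact ⟨fun x => (hfd x).differentiableAt, hFC.continuous⟩
    have hmem : ∀ {x u : ℝ}, u ∈ Set.uIoc 0 x → |u| ≤ |x| := by
      intro x u hu
      rcases Set.mem_uIoc.1 hu with ⟨h1, h2⟩ | ⟨h1, h2⟩
      · rw [abs_of_pos h1, abs_of_pos (h1.trans_le h2)]
        exact h2
      · rw [abs_of_nonpos h2, abs_of_neg (h1.trans_le h2)]
        linarith
    have hFb : ∀ x, |F x| ≤ |x| ^ k * |x| := by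
      intro x
      have := intervalIntegral.norm_integral_le_of_norm_le_const (a := 0) (b := x) (f := g)
        (C := |x| ^ k) fun u hu => by
          rw [Real.norm_eq_abs, abs_of_nonneg (hg0 u)]
          exact (min_le_left _ _).trans (Real.rpow_le_rpow (abs_nonneg u) (hmem hu) hk)
      simpa using this
    have hfb : ∀ x, |f x| ≤ |x| ^ (k + 2) := by
      intro x
      have := intervalIntegral.norm_integral_le_of_norm_le_const (a := 0) (b := x) (f := F)
        (C := |x| ^ k * |x|) fun u hu => by
          rw [Real.norm_eq_abs]
          refine (hFb u).trans ?_
          have := hmem hu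
          gcongr
      rw [hpow]
      calc |f x| ≤ |x| ^ k * |x| * |x| := by simpa using this
        _ = |x| ^ k * |x| ^ 2 := by ring
    have hFb' : ∀ x, |F x| ≤ |x| ^ (k + 2) + 1 := by
      intro x
      refine (hFb x).trans ?_
      have h0 : 0 ≤ |x| ^ k := by positivity
      rcases le_total |x| 1 with hx | hx
      · have h1 : |x| ^ k ≤ 1 := Real.rpow_le_one (abs_nonneg x) hx hk
        have h2 : 0 ≤ |x| ^ (k + 2) := by positivity
        nlinarith [abs_nonneg x]
      · rw [hpow]
        nlinarith [mul_nonneg h0 (sub_nonneg.2 hx)]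
    have hgi : Integrable g ν := by
      refine (integrable_const (n : ℝ)).mono' hgc.aestronglyMeasurable
        (Filter.Eventually.of_forall fun x => ?_)
      rw [Real.norm_eq_abs, abs_of_nonneg (hg0 x)]
      exact min_le_right _ _
    have hfi : Integrable f μ := hμ.mono' hfC.continuous.aestronglyMeasurable
      (Filter.Eventually.of_forall hfb)
    have hFi : Integrable F μ := (hμ.add (integrable_const 1)).mono'
      hFC.continuous.aestronglyMeasurable (Filter.Eventually.of_forall hFb')
    have heq := h f (locallyAC_of_contDiff hfC) (by rw [hfderiv]; exact locallyAC_of_contDiff hFC) hfi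
      (by rwa [hfderiv]) (by rwa [hfderiv, hFderiv])
    rw [hfderiv, hFderiv] at heq
    have hle : ∫ x, (f x - f 0 - m * F x) ∂μ ≤ C := by
      refine integral_mono ((hfi.sub (integrable_const _)).sub (hFi.const_mul _)) hCi fun x => ?_
      have hf0 : f 0 = 0 := by simp [hf]
      have h1 := (abs_le.1 (hfb x)).2
      have h2 : -(m * F x) ≤ |m| * (|x| ^ (k + 2) + 1) := by
        refine (neg_le_abs _).trans ?_
        rw [abs_mul]
        exact mul_le_mul_of_nonneg_left (hFb' x) (abs_nonneg m)
      simp only [hf0]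
      linarith
    refine ⟨hgi, ?_⟩
    rw [← heq] at hle
    rw [div_mul_eq_mul_div, le_div_iff₀ hv]
    linarith
  refine integrable_of_tendsto (G := fun (n : ℕ) x => min (|x| ^ k) (n : ℝ)) 
    (Filter.Eventually.of_forall fun x => ?_) (fun n => (key n).1.1) ?_
  · refine tendsto_const_nhds.congr' ?_
    obtain ⟨N, hN⟩ := exists_nat_ge (|x| ^ k)
    filter_upwards [Filter.eventually_ge_atTop N] with n hn
    rw [min_eq_left (hN.trans (Nat.cast_le.2 hn))]
  · refine ne_top_of_le_ne_top (b := ENNReal.ofReal (2 / (Var[fun x => x; μ] - m ^ 2) * C))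
      ENNReal.ofReal_ne_top ?_
    refine Filter.liminf_le_of_frequently_le' (Filter.Frequently.of_forall fun n => ?_)
    have h0 : ∀ x : ℝ, 0 ≤ min (|x| ^ k) (n : ℝ) :=
      fun x => le_min (by positivity) (by positivity)
    have : ∀ x : ℝ, ‖min (|x| ^ k) (n : ℝ)‖ₑ = ENNReal.ofReal (min (|x| ^ k) (n : ℝ)) :=
      fun x => Real.enorm_of_nonneg (h0 x)
    simp only [this]
    rw [← ofReal_integral_eq_lintegral_ofReal (key n).1 (Filter.Eventually.of_forall h0)]
    exact ENNReal.ofReal_le_ofReal (key n).2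

end Smoothing

/-! ### Distribution functions and the Kolmogorov distance -/

section Kolmogorov

lemma dK_le_of_forall {μ ν : Measure ℝ} {r : ℝ}
    (h : ∀ z, |μ.real (Set.Iic z) - ν.real (Set.Iic z)| ≤ r) : dK μ ν ≤ ENNReal.ofReal r := by
  refine iSup₂_le fun f hf => ENNReal.ofReal_le_ofReal ?_
  obtain ⟨z, rfl⟩ := hf
  rw [integral_indicator_const _ measurableSet_Iic, integral_indicator_const _ measurableSet_Iic,
    smul_eq_mul, smul_eq_mul, mul_one, mul_one]
  exact h z

lemma measureReal_Iic_sub {m : Measure ℝ} [IsFiniteMeasure m] {x y : ℝ} (hxy : x ≤ y) :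
    m.real (Set.Iic y) - m.real (Set.Iic x) = m.real (Set.Ioc x y) := by
  rw [← Set.Iic_union_Ioc_eq_Iic hxy, measureReal_union (Set.Iic_disjoint_Ioc le_rfl)
    measurableSet_Ioc]
  ring

/-- Turns a density bound, expressed on intervals, into a Lipschitz bound for the distribution
function. -/
lemma abs_measureReal_Iic_sub_le {m : Measure ℝ} [IsFiniteMeasure m] {L : ℝ}
    (hL : ∀ x y : ℝ, x ≤ y → m.real (Set.Ioc x y) ≤ L * (y - x)) (x y : ℝ) :
    |m.real (Set.Iic x) - m.real (Set.Iic y)| ≤ L * |x - y| := by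
  rcases le_total x y with h | h
  · rw [abs_sub_comm, measureReal_Iic_sub h, abs_of_nonneg measureReal_nonneg, abs_sub_comm,
      abs_of_nonneg (sub_nonneg.2 h)]
    exact hL x y h
  · rw [measureReal_Iic_sub h, abs_of_nonneg measureReal_nonneg, abs_of_nonneg (sub_nonneg.2 h)]
    exact hL y x h

lemma measurable_measureReal_Iic_sub {m : Measure ℝ} [IsFiniteMeasure m] (z : ℝ) :
    Measurable fun x => m.real (Set.Iic (z - x)) := by
  refine Antitone.measurable fun x y hxy => ?_
  exact measureReal_mono (Set.Iic_subset_Iic.2 (by linarith))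

end Kolmogorov

/-! ### Distance bounds from a coupling satisfying the convolution identity -/

section Coupling

variable {Ω : Type*} [MeasurableSpace Ω] {P : Measure Ω} [IsProbabilityMeasure P]
  {W WA : Ω → ℝ} {p q : Measure ℝ} [IsProbabilityMeasure p] [IsProbabilityMeasure q]

lemma integral_comp_sub_integral_eq (hW : Measurable W) (hWA : Measurable WA)
    (hid : P.map WA + P.map W ∗ q = p + P.map WA ∗ q) {h : ℝ → ℝ}
    (hA : Integrable h (P.map WA)) (hp : Integrable h p)
    (hWq : Integrable h (P.map W ∗ q)) (hAq : Integrable h (P.map WA ∗ q)) :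
    Integrable (fun ω => ∫ y, h (W ω + y) ∂q) P ∧ Integrable (fun ω => ∫ y, h (WA ω + y) ∂q) P ∧
    ∫ ω, h (WA ω) ∂P - ∫ x, h x ∂p
      = ∫ ω, (∫ y, h (WA ω + y) ∂q - ∫ y, h (W ω + y) ∂q) ∂P := by
  have := Measure.isProbabilityMeasure_map (μ := P) hW.aemeasurable
  have := Measure.isProbabilityMeasure_map (μ := P) hWA.aemeasurable
  have i1 := integrable_integral_add hWq
  have i2 := integrable_integral_add hAq
  have j1 := (integrable_map_measure i1.1 hW.aemeasurable).1 i1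
  have j2 := (integrable_map_measure i2.1 hWA.aemeasurable).1 i2
  refine ⟨j1, j2, ?_⟩
  rw [← integral_map hWA.aemeasurable hA.1, integral_sub_integral_eq hid hA hp hWq hAq,
    integral_map hWA.aemeasurable i2.1, integral_map hW.aemeasurable i1.1]
  exact (integral_sub j2 j1).symm

/-- Smoothing the indicator of (-∞, z] by `q` gives x ↦ q((-∞, z - x]). -/
lemma abs_measureReal_Iic_sub_le_integral (hW : Measurable W) (hWA : Measurable WA)
    (hid : P.map WA + P.map W ∗ q = p + P.map WA ∗ q) (z : ℝ) :
    |(P.map WA).real (Set.Iic z) - p.real (Set.Iic z)|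
      ≤ ∫ ω, |q.real (Set.Iic (z - WA ω)) - q.real (Set.Iic (z - W ω))| ∂P := by
  have := Measure.isProbabilityMeasure_map (μ := P) hW.aemeasurable
  have := Measure.isProbabilityMeasure_map (μ := P) hWA.aemeasurable
  have hi : ∀ (m : Measure ℝ) [IsFiniteMeasure m],
      Integrable ((Set.Iic z).indicator fun _ => (1 : ℝ)) m :=
    fun m _ => (integrable_const (1 : ℝ)).indicator measurableSet_Iic
  have hsm : ∀ x : ℝ, ∫ y, (Set.Iic z).indicator (fun _ => (1 : ℝ)) (x + y) ∂q
      = q.real (Set.Iic (z - x)) := by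
    intro x
    have : (fun y => (Set.Iic z).indicator (fun _ => (1 : ℝ)) (x + y))
        = (Set.Iic (z - x)).indicator fun _ => (1 : ℝ) := by
      ext y
      simp only [Set.indicator_apply, Set.mem_Iic, le_sub_iff_add_le, add_comm y]
    rw [this, integral_indicator_const _ measurableSet_Iic, smul_eq_mul, mul_one]
  have key := (integral_comp_sub_integral_eq hW hWA hid (hi _) (hi _) (hi _) (hi _)).2.2
  rw [← integral_map (f := (Set.Iic z).indicator fun _ => (1 : ℝ)) hWA.aemeasurable (hi _).1]
    at key
  simp only [hsm] at key
  rw [integral_indicator_const _ measurableSet_Iic, integral_indicator_const _ measurableSet_Iic,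
    smul_eq_mul, smul_eq_mul, mul_one, mul_one] at key
  rw [key]
  exact abs_integral_le_integral_abs

lemma integrable_abs_measureReal_Iic_sub (hW : Measurable W) (hWA : Measurable WA) (z : ℝ) :
    Integrable (fun ω => |q.real (Set.Iic (z - WA ω)) - q.real (Set.Iic (z - W ω))|) P := by
  have hi : ∀ X : Ω → ℝ, Measurable X → Integrable (fun ω => q.real (Set.Iic (z - X ω))) P := by
    intro X hX
    refine (integrable_const (1 : ℝ)).mono'
      ((measurable_measureReal_Iic_sub z).comp hX).aestronglyMeasurable
      (Filter.Eventually.of_forall fun ω => ?_)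
    rw [Real.norm_eq_abs, abs_of_nonneg measureReal_nonneg]
    exact measureReal_le_one
  exact ((hi WA hWA).sub (hi W hW)).abs

/-- Where |W - W^A| ≤ β the Lipschitz bound gives Lβ; elsewhere two probabilities differ by at most
1. -/
lemma abs_measureReal_equilibrium_Iic_sub_le (hW : Measurable W) (hWA : Measurable WA)
    (hid : P.map WA + P.map W ∗ q = p + P.map WA ∗ q) {L : ℝ} (hL0 : 0 ≤ L)
    (hL : ∀ x y : ℝ, x ≤ y → q.real (Set.Ioc x y) ≤ L * (y - x)) {β : ℝ} (hβ : 0 < β) (z : ℝ) :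
    |(P.map WA).real (Set.Iic z) - p.real (Set.Iic z)|
      ≤ L * β + P.real {ω | β < |W ω - WA ω|} := by
  have hms : MeasurableSet {ω | β < |W ω - WA ω|} :=
    measurableSet_lt measurable_const (hW.sub hWA).abs
  have hi : Integrable ({ω | β < |W ω - WA ω|}.indicator fun _ => (1 : ℝ)) P :=
    (integrable_const (1 : ℝ)).indicator hms
  refine (abs_measureReal_Iic_sub_le_integral hW hWA hid z).trans ?_
  have hmono : ∫ ω, |q.real (Set.Iic (z - WA ω)) - q.real (Set.Iic (z - W ω))| ∂P
      ≤ ∫ ω, (L * β + {ω | β < |W ω - WA ω|}.indicator (fun _ => (1 : ℝ)) ω) ∂P := by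
    refine integral_mono (integrable_abs_measureReal_Iic_sub hW hWA z)
      ((integrable_const _).add hi) fun ω => ?_
    by_cases h : β < |W ω - WA ω|
    · simp only [Set.indicator_of_mem (show ω ∈ {ω | β < |W ω - WA ω|} from h)]
      have h1 : |q.real (Set.Iic (z - WA ω)) - q.real (Set.Iic (z - W ω))| ≤ 1 :=
        abs_sub_le_of_nonneg_of_le measureReal_nonneg measureReal_le_one measureReal_nonneg
          measureReal_le_one
      have : 0 ≤ L * β := by positivity
      linarith
    · simp only [Set.indicator_of_notMem (show ω ∉ {ω | β < |W ω - WA ω|} from h), add_zero]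
      refine (abs_measureReal_Iic_sub_le hL _ _).trans ?_
      rw [sub_sub_sub_cancel_left]
      exact mul_le_mul_of_nonneg_left (not_lt.1 h) hL0
  refine hmono.trans_eq ?_
  rw [integral_add (integrable_const _) hi, integral_indicator_const _ hms]
  simp

/-- Kolmogorov bound for the equilibrium law in terms of the coupling's first moment. -/
lemma dK_equilibrium_le_integral (hW : Measurable W) (hWA : Measurable WA)
    (hid : P.map WA + P.map W ∗ q = p + P.map WA ∗ q) {L : ℝ}
    (hL : ∀ x y : ℝ, x ≤ y → q.real (Set.Ioc x y) ≤ L * (y - x))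
    (hi : Integrable (fun ω => W ω - WA ω) P) :
    dK (P.map WA) p ≤ ENNReal.ofReal (L * ∫ ω, |W ω - WA ω| ∂P) := by
  refine dK_le_of_forall fun z => (abs_measureReal_Iic_sub_le_integral hW hWA hid z).trans ?_
  rw [← integral_const_mul]
  refine integral_mono (integrable_abs_measureReal_Iic_sub hW hWA z) (hi.abs.const_mul L)
    fun ω => ?_
  refine (abs_measureReal_Iic_sub_le hL _ _).trans_eq ?_
  rw [sub_sub_sub_cancel_left]

/-- Kolmogorov bound for `W` in terms of the closeness in probability of the coupling. -/
lemma dK_le_add_measureReal (hW : Measurable W) (hWA : Measurable WA)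
    (hid : P.map WA + P.map W ∗ q = p + P.map WA ∗ q) {L K : ℝ} (hL0 : 0 ≤ L)
    (hL : ∀ x y : ℝ, x ≤ y → q.real (Set.Ioc x y) ≤ L * (y - x))
    (hK : ∀ x y : ℝ, x ≤ y → p.real (Set.Ioc x y) ≤ K * (y - x)) {β : ℝ} (hβ : 0 < β) :
    dK (P.map W) p ≤ ENNReal.ofReal ((K + L) * β + 2 * P.real {ω | β < |W ω - WA ω|}) := by
  refine dK_le_of_forall fun z => ?_
  have hA := fun u => abs_le.1
    (abs_measureReal_equilibrium_Iic_sub_le hW hWA hid hL0 hL hβ u)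
  have hWz : (P.map W).real (Set.Iic z) = P.real {ω | W ω ≤ z} := by
    rw [map_measureReal_apply hW measurableSet_Iic]
    rfl
  have hAz : ∀ u, (P.map WA).real (Set.Iic u) = P.real {ω | WA ω ≤ u} := by
    intro u
    rw [map_measureReal_apply hWA measurableSet_Iic]
    rfl
  -- Off the exceptional event, W ≤ z lies between W^A ≤ z - β and W^A ≤ z + β. Comparing these with
  -- Z costs Lβ and one exceptional probability, and moving the threshold back to z costs Kβ.
  have h1 : P.real {ω | W ω ≤ z}
      ≤ P.real {ω | WA ω ≤ z + β} + P.real {ω | β < |W ω - WA ω|} := by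
    refine (measureReal_mono fun ω hω => ?_).trans (measureReal_union_le _ _)
    by_cases h : β < |W ω - WA ω|
    · exact Or.inr h
    · refine Or.inl ?_
      have := (abs_le.1 (not_lt.1 h)).1
      simp only [Set.mem_ofPred_eq] at hω ⊢
      linarith
  have h2 : P.real {ω | WA ω ≤ z - β}
      ≤ P.real {ω | W ω ≤ z} + P.real {ω | β < |W ω - WA ω|} := by
    refine (measureReal_mono fun ω hω => ?_).trans (measureReal_union_le _ _)
    by_cases h : β < |W ω - WA ω|
    · exact Or.inr h
    · refine Or.inl ?_
      have := (abs_le.1 (not_lt.1 h)).2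
      simp only [Set.mem_ofPred_eq] at hω ⊢
      linarith
  have h3 := (abs_le.1 (abs_measureReal_Iic_sub_le hK (z + β) z)).2
  have h4 := (abs_le.1 (abs_measureReal_Iic_sub_le hK (z - β) z)).1
  rw [add_sub_cancel_left, abs_of_pos hβ] at h3
  rw [sub_sub_cancel_left, abs_neg, abs_of_pos hβ] at h4
  have h5 := (hA (z + β)).2
  have h6 := (hA (z - β)).1
  rw [hAz] at h5 h6
  rw [hWz, abs_le]
  constructor <;> linarith

/-- Optimising a bound `A' β + B' P(|X| > β)` over `β` through Markov's inequality. -/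
lemma le_ofReal_rpow_of_forall_le {X : Ω → ℝ} {k A B A' B' : ℝ} (hk : 1 ≤ k)
    (hX : Integrable (fun ω => |X ω| ^ k) P) (hA : 0 < A) (hB : 0 < B)
    (hA' : A' ≤ 2 / 7 * A) (hB' : B' ≤ 2 / 5 * B) {d : ℝ≥0∞}
    (hd : ∀ β : ℝ, 0 < β → d ≤ ENNReal.ofReal (A' * β + B' * P.real {ω | β < |X ω|})) :
    d ≤ ENNReal.ofReal (A ^ (k / (k + 1))
      * ((k + k ^ (-k)) * B * ∫ ω, |X ω| ^ k ∂P) ^ (1 / (k + 1))) := by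
  have hk0 : 0 < k := zero_lt_one.trans_le hk
  set M := ∫ ω, |X ω| ^ k ∂P with hM
  have hX0 : ∀ ω, 0 ≤ |X ω| ^ k := fun ω => by positivity
  have hM0 : 0 ≤ M := integral_nonneg hX0
  rcases hM0.eq_or_lt with hM1 | hM1
  · have hz : (fun ω => |X ω| ^ k) =ᵐ[P] 0 := (integral_eq_zero_iff_of_nonneg hX0 hX).1 hM1.symm
    have hP : ∀ β : ℝ, 0 < β → P.real {ω | β < |X ω|} = 0 := by
      intro β hβ
      rw [measureReal_eq_zero_iff]
      refine measure_mono_null (fun ω hω => ?_) (ae_iff.1 hz)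
      have : 0 < |X ω| ^ k := Real.rpow_pos_of_pos (hβ.trans hω) k
      exact this.ne'
    -- Here X = 0 almost surely, so only the β term survives, and β can be taken arbitrarily small.
    refine ENNReal.le_of_forall_pos_le_add fun ε hε _ => ?_
    have hε' : (0 : ℝ) < ε := hε
    refine (hd (ε / A) (by positivity)).trans (le_add_left ?_)
    rw [hP _ (by positivity), mul_zero, add_zero]
    refine ENNReal.ofReal_le_of_le_toReal ?_
    calc A' * (ε / A) ≤ 2 / 7 * A * (ε / A) := by gcongr
      _ = 2 / 7 * ε := by field_simp
      _ ≤ ε := by linarith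
  -- β = R/A minimises Aβ + BMβ^(-k): it solves β^(k+1) = kBM/A. Then Aβ = R and the Markov term is
  -- at most R/k.
  · set R := A ^ (k / (k + 1)) * (k * B * M) ^ (1 / (k + 1)) with hR
    have hR0 : 0 < R := by positivity
    have hRpow : R ^ k * R = A ^ k * (k * B * M) := by
      have e : R ^ k * R = R ^ (k + 1) := by rw [Real.rpow_add_one hR0.ne']
      rw [e, hR, Real.mul_rpow (by positivity) (by positivity), ← Real.rpow_mul hA.le,
        ← Real.rpow_mul (by positivity), div_mul_cancel₀ _ (by positivity),
        div_mul_cancel₀ _ (by positivity), Real.rpow_one]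
    have hβ : 0 < R / A := by positivity
    have hmarkov : (R / A) ^ k * P.real {ω | R / A < |X ω|} ≤ M := by
      refine le_trans ?_ (mul_meas_ge_le_integral_of_nonneg (Filter.Eventually.of_forall hX0) hX
        ((R / A) ^ k))
      refine mul_le_mul_of_nonneg_left (measureReal_mono fun ω hω => ?_) (by positivity)
      exact Real.rpow_le_rpow hβ.le (le_of_lt hω) hk0.le
    have hp : B * P.real {ω | R / A < |X ω|} ≤ R / k := by
      have hRk : 0 < R ^ k := by positivity
      rw [Real.div_rpow hR0.le hA.le, div_mul_eq_mul_div, div_le_iff₀ (by positivity)] at hmarkov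
      rw [le_div_iff₀ hk0]
      refine le_of_mul_le_mul_left ?_ hRk
      calc R ^ k * (B * P.real {ω | R / A < |X ω|} * k)
          = (B * k) * (R ^ k * P.real {ω | R / A < |X ω|}) := by ring
        _ ≤ (B * k) * (M * A ^ k) := by gcongr
        _ = R ^ k * R := by rw [hRpow]; ring
    refine (hd (R / A) hβ).trans (ENNReal.ofReal_le_ofReal ?_)
    calc A' * (R / A) + B' * P.real {ω | R / A < |X ω|}
        ≤ 2 / 7 * A * (R / A) + 2 / 5 * B * P.real {ω | R / A < |X ω|} := by gcongr
      _ = 2 / 7 * R + 2 / 5 * (B * P.real {ω | R / A < |X ω|}) := by field_simp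
      _ ≤ 2 / 7 * R + 2 / 5 * (R / k) := by gcongr
      -- As k ≥ 1 and 2/7 + 2/5 < 1, the slack in `A'`, `B'` absorbs both terms into one R; the
      -- summand k^(-k) only enlarges the bound.
      _ ≤ R := by linarith [div_le_self hR0.le hk]
      _ ≤ _ := by
        have : 0 ≤ k ^ (-k) := by positivity
        rw [hR]
        gcongr
        linarith

lemma abs_integral_add_sub_le {h : ℝ → ℝ} (hh : LipschitzWith 1 h) (hq : MemLp id 1 q) (x y : ℝ) :
    |∫ u, h (x + u) ∂q - ∫ u, h (y + u) ∂q| ≤ |x - y| := by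
  simpa [Real.dist_eq] using (lipschitzWith_integral_add hq hh).dist_le_mul x y

lemma abs_integral_sub_le_of_lipschitzWith (hW : Measurable W) (hWA : Measurable WA)
    (hid : P.map WA + P.map W ∗ q = p + P.map WA ∗ q) (hp : MemLp id 1 p) (hq : MemLp id 1 q)
    (hW1 : MemLp W 1 P) (hWA1 : MemLp WA 1 P) {h : ℝ → ℝ} (hh : LipschitzWith 1 h) :
    |∫ ω, h (WA ω) ∂P - ∫ x, h x ∂p| ≤ ∫ ω, |W ω - WA ω| ∂P ∧
      |∫ ω, h (W ω) ∂P - ∫ ω, h (WA ω) ∂P| ≤ ∫ ω, |W ω - WA ω| ∂P := by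
  have := Measure.isProbabilityMeasure_map (μ := P) hW.aemeasurable
  have := Measure.isProbabilityMeasure_map (μ := P) hWA.aemeasurable
  have mW : MemLp id 1 (P.map W) :=
    (memLp_map_measure_iff (by fun_prop) hW.aemeasurable).2 hW1
  have mA : MemLp id 1 (P.map WA) :=
    (memLp_map_measure_iff (by fun_prop) hWA.aemeasurable).2 hWA1
  have iW := integrable_of_lipschitzWith mW hh
  have iA := integrable_of_lipschitzWith mA hh
  obtain ⟨j1, j2, key⟩ := integral_comp_sub_integral_eq hW hWA hid iA
    (integrable_of_lipschitzWith hp hh) (integrable_of_lipschitzWith (memLp_id_conv mW hq) hh)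
    (integrable_of_lipschitzWith (memLp_id_conv mA hq) hh)
  have hd : Integrable (fun ω => |W ω - WA ω|) P :=
    ((memLp_one_iff_integrable.1 hW1).sub (memLp_one_iff_integrable.1 hWA1)).abs
  have kW : Integrable (fun ω => h (W ω)) P := (integrable_map_measure iW.1 hW.aemeasurable).1 iW
  have kA : Integrable (fun ω => h (WA ω)) P :=
    (integrable_map_measure iA.1 hWA.aemeasurable).1 iA
  constructor
  · rw [key]
    refine abs_integral_le_integral_abs.trans (integral_mono (j2.sub j1).abs hd fun ω => ?_)
    exact (abs_integral_add_sub_le hh hq _ _).trans_eq (abs_sub_comm _ _)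
  · rw [← integral_sub kW kA]
    refine abs_integral_le_integral_abs.trans (integral_mono (kW.sub kA).abs hd fun ω => ?_)
    simpa [Real.dist_eq] using hh.dist_le_mul (W ω) (WA ω)

lemma dW_equilibrium_le (hW : Measurable W) (hWA : Measurable WA)
    (hid : P.map WA + P.map W ∗ q = p + P.map WA ∗ q) (hp : MemLp id 1 p) (hq : MemLp id 1 q)
    (hW1 : MemLp W 1 P) (hWA1 : MemLp WA 1 P) :
    dW (P.map WA) p ≤ ENNReal.ofReal (∫ ω, |W ω - WA ω| ∂P) := by
  refine iSup₂_le fun h hh => ENNReal.ofReal_le_ofReal ?_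
  have hh' : LipschitzWith 1 h := hh
  rw [integral_map hWA.aemeasurable hh'.continuous.aestronglyMeasurable]
  exact (abs_integral_sub_le_of_lipschitzWith hW hWA hid hp hq hW1 hWA1 hh').1

lemma dW_le (hW : Measurable W) (hWA : Measurable WA)
    (hid : P.map WA + P.map W ∗ q = p + P.map WA ∗ q) (hp : MemLp id 1 p) (hq : MemLp id 1 q)
    (hW1 : MemLp W 1 P) (hWA1 : MemLp WA 1 P) :
    dW (P.map W) p ≤ ENNReal.ofReal (2 * ∫ ω, |W ω - WA ω| ∂P) := by
  refine iSup₂_le fun h hh => ENNReal.ofReal_le_ofReal ?_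
  have hh' : LipschitzWith 1 h := hh
  rw [integral_map hW.aemeasurable hh'.continuous.aestronglyMeasurable]
  obtain ⟨h1, h2⟩ :=
    abs_integral_sub_le_of_lipschitzWith hW hWA hid hp hq hW1 hWA1 hh'
  refine (abs_sub_le _ (∫ ω, h (WA ω) ∂P) _).trans ?_
  linarith

/-- Bound in the smooth distance through the conditional drift of the coupling. -/
lemma d2_le (hW : Measurable W) (hWA : Measurable WA)
    (hid : P.map WA + P.map W ∗ q = p + P.map WA ∗ q) (hp : MemLp id 2 p) (hq : MemLp id 2 q)
    (hW2 : MemLp W 2 P) (hWA2 : MemLp WA 2 P) :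
    d2 (P.map W) p ≤ ENNReal.ofReal ((∫ y, |y| ∂q)
      * (∫ ω, |(P[fun ω' => W ω' - WA ω' | MeasurableSpace.comap W inferInstance]) ω| ∂P)
        + ∫ ω, (W ω - WA ω) ^ 2 ∂P) := by
  refine iSup₂_le fun h hh => ENNReal.ofReal_le_ofReal ?_
  have hm : MeasurableSpace.comap W inferInstance ≤ (inferInstance : MeasurableSpace Ω) :=
    hW.comap_le
  have := Measure.isProbabilityMeasure_map (μ := P) hW.aemeasurable
  have := Measure.isProbabilityMeasure_map (μ := P) hWA.aemeasurable
  have mW : MemLp id 2 (P.map W) :=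
    (memLp_map_measure_iff (by fun_prop) hW.aemeasurable).2 hW2
  have mA : MemLp id 2 (P.map WA) :=
    (memLp_map_measure_iff (by fun_prop) hWA.aemeasurable).2 hWA2
  have hq1 : MemLp id 1 q := hq.mono_exponent one_le_two
  have iW := integrable_of_mem_smoothClass mW hh
  have iA := integrable_of_mem_smoothClass mA hh
  obtain ⟨j1, j2, key⟩ := integral_comp_sub_integral_eq hW hWA hid iA
    (integrable_of_mem_smoothClass hp hh) (integrable_of_mem_smoothClass (memLp_id_conv mW hq) hh)
    (integrable_of_mem_smoothClass (memLp_id_conv mA hq) hh)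
  have kW : Integrable (fun ω => h (W ω)) P := (integrable_map_measure iW.1 hW.aemeasurable).1 iW
  have kA : Integrable (fun ω => h (WA ω)) P :=
    (integrable_map_measure iA.1 hWA.aemeasurable).1 iA
  have hΔ : MemLp (fun ω => W ω - WA ω) 2 P := hW2.sub hWA2
  have hΔ1 : Integrable (fun ω => W ω - WA ω) P := hΔ.integrable one_le_two
  have hΔ2 : Integrable (fun ω => (W ω - WA ω) ^ 2) P := hΔ.integrable_sq
  have hder : ∀ x, Integrable (fun y => deriv h (x + y)) q := fun x =>
    integrable_of_lipschitzWith hq1 (K := 1 * 1)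
      (hh.2.comp (LipschitzWith.of_dist_le_mul fun u v => by
        rw [dist_add_left, NNReal.coe_one, one_mul]))
  have hshift : ∀ x, Integrable (fun y => h (x + y)) q := by
    intro x
    refine integrable_of_mem_smoothClass hq (h := fun y => h (x + y)) ⟨?_, ?_⟩
    · exact hh.1.comp (by fun_prop)
    · have e : deriv (fun y => h (x + y)) = fun y => deriv h (x + y) :=
        funext fun y => deriv_comp_const_add ..
      rw [e]
      refine LipschitzWith.of_dist_le_mul fun u v => ?_
      have := hh.2.dist_le_mul (x + u) (x + v)
      rwa [dist_add_left] at this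
  -- G is h' - Qh', the coefficient of W - W^A once h and Qh are both expanded at W.
  set G : ℝ → ℝ := fun x => deriv h x - ∫ y, deriv h (x + y) ∂q with hG
  have hGc : Continuous G :=
    hh.2.continuous.sub (lipschitzWith_integral_add hq1 hh.2).continuous
  have hGb : ∀ x, |G x| ≤ ∫ y, |y| ∂q := by
    intro x
    have e : G x = ∫ y, (deriv h x - deriv h (x + y)) ∂q := by
      rw [integral_sub (integrable_const _) (hder x)]
      simp [hG]
    rw [e]
    refine abs_integral_le_integral_abs.trans (integral_mono
      ((integrable_const _).sub (hder x)).abs (hq.integrable one_le_two).abs fun y => ?_)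
    simpa [Real.dist_eq] using hh.2.dist_le_mul x (x + y)
  have htaylor : ∀ x x' : ℝ, |∫ y, h (x' + y) ∂q - ∫ y, h (x + y) ∂q
      - (∫ y, deriv h (x + y) ∂q) * (x' - x)| ≤ (x' - x) ^ 2 / 2 := by
    intro x x'
    rw [← integral_sub (hshift x') (hshift x), ← integral_mul_const,
      ← integral_sub (f := fun y => h (x' + y) - h (x + y)) ((hshift x').sub (hshift x)) ((hder x).mul_const _)]
    have hb := norm_integral_le_of_norm_le_const (μ := q) (C := (x' - x) ^ 2 / 2)
      (f := fun y => h (x' + y) - h (x + y) - deriv h (x + y) * (x' - x))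
      (Filter.Eventually.of_forall fun y => ?_)
    · rwa [probReal_univ, mul_one] at hb
    have := abs_sub_sub_deriv_mul_le hh.1 hh.2 (x + y) (x' + y)
    rwa [add_sub_add_right_eq_sub] at this
  have hGW : StronglyMeasurable[MeasurableSpace.comap W inferInstance] (fun ω => G (W ω)) :=
    (hGc.measurable.comp (comap_measurable W)).stronglyMeasurable
  have hprod : Integrable (fun ω => (W ω - WA ω) * G (W ω)) P :=
    hΔ1.mul_bdd (c := ∫ y, |y| ∂q) (hGc.measurable.comp hW).aestronglyMeasurable
      (Filter.Eventually.of_forall fun ω => hGb (W ω))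
  -- G(W) is a function of W, so it comes out of the conditional expectation and only the drift E[W
  -- - W^A | W] remains.
  have hce := condExp_mul_of_stronglyMeasurable_right hGW hprod hΔ1
  have hmain : |∫ ω, (W ω - WA ω) * G (W ω) ∂P| ≤ (∫ y, |y| ∂q)
      * ∫ ω, |(P[fun ω' => W ω' - WA ω' | MeasurableSpace.comap W inferInstance]) ω| ∂P := by
    have e : ∫ ω, (W ω - WA ω) * G (W ω) ∂P = ∫ ω, (P[fun ω' => W ω' - WA ω' |
        MeasurableSpace.comap W inferInstance]) ω * G (W ω) ∂P := by
      exact (integral_condExp hm).symm.trans (integral_congr_ae hce)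
    rw [e, ← integral_const_mul]
    refine abs_integral_le_integral_abs.trans (integral_mono
      ((integrable_condExp.congr hce).abs) (integrable_condExp.abs.const_mul _) fun ω => ?_)
    simp only [abs_mul]
    rw [mul_comm]
    exact mul_le_mul_of_nonneg_right (hGb _) (abs_nonneg _)
  have hrem : |∫ ω, (h (W ω) - h (WA ω) + (∫ y, h (WA ω + y) ∂q - ∫ y, h (W ω + y) ∂q)
      - (W ω - WA ω) * G (W ω)) ∂P| ≤ ∫ ω, (W ω - WA ω) ^ 2 ∂P := by
    refine abs_integral_le_integral_abs.trans (integral_mono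
      (((kW.sub kA).add (j2.sub j1)).sub hprod).abs hΔ2 fun ω => ?_)
    have h1 := abs_le.1 (abs_sub_sub_deriv_mul_le hh.1 hh.2 (W ω) (WA ω))
    have h2 := abs_le.1 (htaylor (W ω) (WA ω))
    simp only [hG]
    rw [abs_le]
    -- The two Taylor remainders, of h and of Qh, contribute (W - W^A)²/2 each.
    constructor <;> nlinarith [h1.1, h1.2, h2.1, h2.2]
  rw [integral_sub (f := fun ω => h (W ω) - h (WA ω)
    + (∫ y, h (WA ω + y) ∂q - ∫ y, h (W ω + y) ∂q)) ((kW.sub kA).add (j2.sub j1)) hprod,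
    integral_add (f := fun ω => h (W ω) - h (WA ω))
      (g := fun ω => ∫ y, h (WA ω + y) ∂q - ∫ y, h (W ω + y) ∂q) (kW.sub kA) (j2.sub j1), ← key,
    integral_sub kW kA] at hrem
  rw [integral_map hW.aemeasurable iW.1]
  have h1 := abs_le.1 hmain
  have h2 := abs_le.1 hrem
  rw [abs_le]
  constructor <;> linarith [h1.1, h1.2, h2.1, h2.2]

/-- W^A has two moments fewer than W, because the relation integrates f'' against its law and f
against that of W. -/
lemma memLp_of_isAsymEquilibrium (hW : Measurable W) (hWA : Measurable WA)
    (hA : IsAsymEquilibrium (P.map WA) (P.map W))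
    (hv : 0 < Var[fun x => x; P.map W] - (∫ x, x ∂(P.map W)) ^ 2) {k : ℝ} (hk : 0 < k)
    (hWk : Integrable (fun ω => |W ω| ^ (k + 2)) P) :
    MemLp W (ENNReal.ofReal k) P ∧ MemLp WA (ENNReal.ofReal k) P := by
  have := Measure.isProbabilityMeasure_map (μ := P) hW.aemeasurable
  have := Measure.isProbabilityMeasure_map (μ := P) hWA.aemeasurable
  have hiff : ∀ {X : Ω → ℝ} (_ : Measurable X) {r : ℝ} (_ : 0 < r),
      Integrable (fun ω => |X ω| ^ r) P → MemLp X (ENNReal.ofReal r) P := by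
    intro X hX r hr hi
    rw [← integrable_norm_rpow_iff hX.aestronglyMeasurable (by simpa using hr)
      ENNReal.ofReal_ne_top, ENNReal.toReal_ofReal hr.le]
    exact hi
  refine ⟨(hiff hW (by positivity) hWk).mono_exponent
    (ENNReal.ofReal_le_ofReal (by linarith)), hiff hWA hk ?_⟩
  have hm : ∀ r : ℝ, Measurable fun x : ℝ => |x| ^ r := fun r => by fun_prop
  have hi : Integrable (fun x => |x| ^ (k + 2)) (P.map W) :=
    (integrable_map_measure (hm _).aestronglyMeasurable hW.aemeasurable).2 hWk
  exact (integrable_map_measure (hm _).aestronglyMeasurable hWA.aemeasurable).1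
    (integrable_rpow_of_isAsymEquilibrium hA hv hk.le hi)

end Coupling

/-! ### The smoothing kernel of the asymmetric Laplace law -/

/-- The smoothing kernel `q` whose convolution identity characterises the equilibrium coupling. -/
noncomputable def smoothingKernel (a v s : ℝ) : Measure ℝ :=
  biexp ((s - a) ^ 2 / (2 * v * s)) ((s + a) ^ 2 / (2 * v * s)) ((s - a) / v) ((s + a) / v)

section Kernel

variable {a v s : ℝ}

/-- Since s² = 2v + a², the denominator factors as 2v(1 - iat + vt²/2) = (s - a - ivt)(s + a + ivt).
Partial fractions of (1 - iat) φ_p then have the positive weights (s ∓ a)²/(2vs), which is why `q`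
is a genuine law. -/
lemma charFun_biexp_target (hv : 0 < v) (hs : |a| < s) (hs2 : s ^ 2 = 2 * v + a ^ 2) (t : ℝ) :
    (1 - a * t * Complex.I + v / 2 * t ^ 2)
      * charFun (biexp (1 / s) (1 / s) ((s - a) / v) ((s + a) / v)) t = 1 ∧
    charFun (smoothingKernel a v s) t = (1 - a * t * Complex.I)
      * charFun (biexp (1 / s) (1 / s) ((s - a) / v) ((s + a) / v)) t := by
  have hs0 : 0 < s := (abs_nonneg a).trans_lt hs
  obtain ⟨ha1, ha2⟩ := abs_lt.1 hs
  have hl1 : 0 < (s - a) / v := div_pos (by linarith) hv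
  have hl2 : 0 < (s + a) / v := div_pos (by linarith) hv
  have hvC : (v : ℂ) ≠ 0 := by exact_mod_cast hv.ne'
  have hsC : (s : ℂ) ≠ 0 := by exact_mod_cast hs0.ne'
  have hs2C : (s : ℂ) ^ 2 = 2 * v + a ^ 2 := by exact_mod_cast hs2
  have hI := Complex.I_sq
  have h1 : (s - a - v * t * Complex.I : ℂ) ≠ 0 := by
    intro h
    have := congrArg Complex.re h
    simp at this
    linarith
  have h2 : (s + a + v * t * Complex.I : ℂ) ≠ 0 := by
    intro h
    have := congrArg Complex.re h
    simp at this
    linarith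
  have e1 : ((s - a) / v - t * Complex.I : ℂ) = (s - a - v * t * Complex.I) / v := by
    field_simp
  have e2 : ((s + a) / v + t * Complex.I : ℂ) = (s + a + v * t * Complex.I) / v := by
    field_simp
  have hp : charFun (biexp (1 / s) (1 / s) ((s - a) / v) ((s + a) / v)) t
      = 2 * v / ((s - a - v * t * Complex.I) * (s + a + v * t * Complex.I)) := by
    rw [charFun_biexp (by positivity) (by positivity) hl1 hl2]
    push_cast
    rw [e1, e2]
    field_simp
    ring
  have hden : ((s - a - v * t * Complex.I) * (s + a + v * t * Complex.I) : ℂ)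
      = 2 * v * (1 - a * t * Complex.I + v / 2 * t ^ 2) := by
    linear_combination hs2C - v ^ 2 * t ^ 2 * hI
  constructor
  · rw [hp, hden]
    have : (1 - a * t * Complex.I + v / 2 * t ^ 2 : ℂ) ≠ 0 := by
      intro h
      rw [h, mul_zero] at hden
      exact mul_ne_zero h1 h2 hden
    rw [mul_div_assoc', div_eq_one_iff_eq (mul_ne_zero (mul_ne_zero two_ne_zero hvC) this)]
    ring
  · rw [hp, smoothingKernel, charFun_biexp (by positivity) (by positivity) hl1 hl2]
    push_cast
    rw [e1, e2]
    field_simp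
    linear_combination 2 * s * hs2C

lemma isProbabilityMeasure_biexp_target (hv : 0 < v) (hs : |a| < s)
    (hs2 : s ^ 2 = 2 * v + a ^ 2) :
    IsProbabilityMeasure (biexp (1 / s) (1 / s) ((s - a) / v) ((s + a) / v)) := by
  have hs0 : 0 < s := (abs_nonneg a).trans_lt hs
  obtain ⟨ha1, ha2⟩ := abs_lt.1 hs
  have h1 : 0 < s - a := by linarith
  have h2 : 0 < s + a := by linarith
  refine isProbabilityMeasure_biexp (by positivity) (by positivity) (by positivity)
    (by positivity) ?_
  field_simp
  linear_combination -s * hs2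

lemma isProbabilityMeasure_smoothingKernel (hv : 0 < v) (hs : |a| < s) :
    IsProbabilityMeasure (smoothingKernel a v s) := by
  have hs0 : 0 < s := (abs_nonneg a).trans_lt hs
  obtain ⟨ha1, ha2⟩ := abs_lt.1 hs
  have h1 : 0 < s - a := by linarith
  have h2 : 0 < s + a := by linarith
  refine isProbabilityMeasure_biexp (by positivity) (by positivity) (by positivity)
    (by positivity) ?_
  field_simp
  ring

lemma integral_abs_smoothingKernel (hv : 0 < v) (hs : |a| < s) :
    ∫ y, |y| ∂(smoothingKernel a v s) = v / s := by
  have hs0 : 0 < s := (abs_nonneg a).trans_lt hs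
  obtain ⟨ha1, ha2⟩ := abs_lt.1 hs
  have h1 : 0 < s - a := by linarith
  have h2 : 0 < s + a := by linarith
  have h := (integrable_biexp_abs_pow (c₁ := (s - a) ^ 2 / (2 * v * s))
    (c₂ := (s + a) ^ 2 / (2 * v * s)) (l₁ := (s - a) / v) (l₂ := (s + a) / v) (by positivity)
    (by positivity) (by positivity) (by positivity) 1).2
  simp only [pow_one, Nat.factorial_one, Nat.cast_one, one_mul, one_add_one_eq_two, div_pow] at h
  have h3 := h1.ne'
  have h4 := h2.ne'
  rw [smoothingKernel, h]
  field_simp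
  norm_num

lemma memLp_id_smoothingKernel (hv : 0 < v) (hs : |a| < s) :
    MemLp id 2 (smoothingKernel a v s) := by
  have hs0 : 0 < s := (abs_nonneg a).trans_lt hs
  obtain ⟨ha1, ha2⟩ := abs_lt.1 hs
  have h1 : 0 < s - a := by linarith
  have h2 : 0 < s + a := by linarith
  exact memLp_id_biexp (by positivity) (by positivity) (by positivity) (by positivity)

lemma smoothingKernel_real_Ioc_le (hv : 0 < v) (hs : |a| < s) (hs2 : s ^ 2 = 2 * v + a ^ 2)
    (x y : ℝ) (hxy : x ≤ y) :
    (smoothingKernel a v s).real (Set.Ioc x y) ≤ (1 / s + 2 * |a| / v) * (y - x) := by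
  have hs0 : 0 < s := (abs_nonneg a).trans_lt hs
  obtain ⟨ha1, ha2⟩ := abs_lt.1 hs
  have h1 : 0 < s - a := by linarith
  have h2 : 0 < s + a := by linarith
  have hle : ∀ e : ℝ, |e| = |a| → (s + e) ^ 2 / (2 * v * s) ≤ 1 / s + 2 * |a| / v := by
    intro e he
    have h3 : e ≤ |a| := he ▸ le_abs_self e
    have h4 : e ^ 2 = |a| ^ 2 := by rw [← sq_abs, he]
    have h5 : a ^ 2 = |a| ^ 2 := (sq_abs a).symm
    rw [div_add_div _ _ hs0.ne' hv.ne', div_le_div_iff₀ (by positivity) (by positivity)]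
    -- (s + |a|)² = 2v + 2a² + 2s|a|, and a² ≤ s|a| bounds this by 2v + 4s|a|.
    have h6 : (s + e) ^ 2 ≤ 2 * (1 * v + s * (2 * |a|)) := by
      nlinarith [mul_nonneg (abs_nonneg a) (sub_nonneg.2 hs.le)]
    nlinarith [mul_le_mul_of_nonneg_right h6 (mul_pos hs0 hv).le]
  exact biexp_real_Ioc_le (by positivity) (by positivity) (by positivity) (by positivity)
    (by simpa [sub_eq_add_neg] using hle (-a) (abs_neg a)) (hle a rfl) hxy

end Kernel

end AsymLaplace

/-! ### Assembly of the theorem -/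

open AsymLaplace in
theorem theorem3p5 {Ω : Type*} [MeasurableSpace Ω] (P : Measure Ω) [IsProbabilityMeasure P]
    (W WA : Ω → ℝ) (hW : Measurable W) (hWA : Measurable WA) (hW2 : MemLp W 2 P)
    (a σ : ℝ) (hmean : ∫ ω, W ω ∂P = a) (hvar : Var[W; P] = σ ^ 2) (hσ : a ^ 2 < σ ^ 2)
    (hA : AsymLaplace.IsAsymEquilibrium (P.map WA) (P.map W))
    (Z : Measure ℝ) (hZ : Z = AsymLaplace.asymLaplace 0 a (√(σ ^ 2 - a ^ 2))) :
    -- (i)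
    (∀ β : ℝ, 0 < β →
      AsymLaplace.dK (P.map W) Z ≤ ENNReal.ofReal
        ((14 / √(2 * σ ^ 2 - a ^ 2) + 7 * |a| / (σ ^ 2 - a ^ 2)) * β
          + (5 + 7 * |a| / √(2 * σ ^ 2 - a ^ 2)) * P.real {ω | β < |W ω - WA ω|})
      ∧ AsymLaplace.dK (P.map WA) Z ≤ ENNReal.ofReal
        ((2 / √(2 * σ ^ 2 - a ^ 2) + 4 * |a| / (σ ^ 2 - a ^ 2)) * β
          + (2 + 4 * |a| / √(2 * σ ^ 2 - a ^ 2)) * P.real {ω | β < |W ω - WA ω|}))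
    ∧ (∀ k : ℝ, 1 ≤ k → Integrable (fun ω => |W ω| ^ (k + 2)) P →
      AsymLaplace.dK (P.map W) Z ≤ ENNReal.ofReal
        ((14 / √(2 * σ ^ 2 - a ^ 2) + 7 * |a| / (σ ^ 2 - a ^ 2)) ^ (k / (k + 1))
          * ((k + k ^ (-k)) * (5 + 7 * |a| / √(2 * σ ^ 2 - a ^ 2))
              * ∫ ω, |W ω - WA ω| ^ k ∂P) ^ (1 / (k + 1))))
    -- (ii)
    ∧ (Integrable (fun ω => |W ω| ^ 3) P →
      AsymLaplace.dW (P.map W) Z ≤ ENNReal.ofReal (2 * ∫ ω, |W ω - WA ω| ∂P)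
      ∧ AsymLaplace.dW (P.map WA) Z ≤ ENNReal.ofReal
        ((1 + 2 / √(2 * σ ^ 2 - a ^ 2)) * ∫ ω, |W ω - WA ω| ∂P)
      ∧ AsymLaplace.dW (P.map WA) Z ≤ ENNReal.ofReal
        ((1 + 2 * |a| / √(2 * σ ^ 2 - a ^ 2)) * ∫ ω, |W ω - WA ω| ∂P)
      ∧ AsymLaplace.dK (P.map WA) Z ≤ ENNReal.ofReal
        ((2 / √(2 * σ ^ 2 - a ^ 2) + 4 * |a| / (σ ^ 2 - a ^ 2)) * ∫ ω, |W ω - WA ω| ∂P))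
    -- (iii)
    ∧ (Integrable (fun ω => W ω ^ 4) P →
      AsymLaplace.d2 (P.map W) Z ≤ ENNReal.ofReal
        ((σ ^ 2 - a ^ 2) / √(2 * σ ^ 2 - a ^ 2)
            * (∫ ω, |(P[fun ω' => W ω' - WA ω' | MeasurableSpace.comap W inferInstance]) ω| ∂P)
          + ∫ ω, (W ω - WA ω) ^ 2 ∂P)) := by
  set v := σ ^ 2 - a ^ 2 with hv
  set s := √(2 * σ ^ 2 - a ^ 2) with hs
  have hv0 : 0 < v := sub_pos.2 hσ
  have hs2 : s ^ 2 = 2 * v + a ^ 2 := by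
    rw [hs, Real.sq_sqrt (by nlinarith [sq_nonneg a]), hv]
    ring
  have has : |a| < s := by
    refine lt_of_pow_lt_pow_left₀ 2 (Real.sqrt_nonneg _) ?_
    rw [sq_abs, hs2]
    linarith
  have hs0 : 0 < s := (abs_nonneg a).trans_lt has
  obtain ⟨ha1, ha2⟩ := abs_lt.1 has
  have hsa : 0 < s - a := by linarith
  have hsa' : 0 < s + a := by linarith
  have hZ' : Z = biexp (1 / s) (1 / s) ((s - a) / v) ((s + a) / v) := by
    have e : 2 * √v ^ 2 + a ^ 2 = 2 * σ ^ 2 - a ^ 2 := by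
      rw [Real.sq_sqrt hv0.le, hv]
      ring
    rw [hZ, asymLaplace_eq_biexp a (Real.sqrt_pos.2 hv0), e, Real.sq_sqrt hv0.le]
  have hWp := Measure.isProbabilityMeasure_map (μ := P) hW.aemeasurable
  have hWAp := Measure.isProbabilityMeasure_map (μ := P) hWA.aemeasurable
  have hZp : IsProbabilityMeasure Z := hZ' ▸ isProbabilityMeasure_biexp_target hv0 has hs2
  have hqp := isProbabilityMeasure_smoothingKernel hv0 has
  have hm : ∫ x, x ∂(P.map W) = a := by
    rw [integral_map (f := fun x => x) hW.aemeasurable aestronglyMeasurable_id, hmean]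
  have hva : Var[fun x => x; P.map W] = σ ^ 2 := by
    rw [variance_map (by fun_prop) hW.aemeasurable, ← hvar]
    rfl
  have hid : P.map WA + P.map W ∗ smoothingKernel a v s
      = Z + P.map WA ∗ smoothingKernel a v s :=
    add_conv_eq_add_conv hA hm (by rw [hva])
      (fun t => hZ' ▸ (charFun_biexp_target hv0 has hs2 t).1)
      (fun t => hZ' ▸ (charFun_biexp_target hv0 has hs2 t).2)
  have hL := smoothingKernel_real_Ioc_le hv0 has hs2
  have hL0 : 0 ≤ 1 / s + 2 * |a| / v := by positivity
  have hK : ∀ x y : ℝ, x ≤ y → Z.real (Set.Ioc x y) ≤ 1 / s * (y - x) := fun x y hxy => by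
    rw [hZ']
    exact biexp_real_Ioc_le (by positivity) (by positivity) (by positivity) (by positivity)
      le_rfl le_rfl hxy
  have hZ2 : MemLp id 2 Z := hZ' ▸
    memLp_id_biexp (by positivity) (by positivity) (by positivity) (by positivity)
  have hq2 := memLp_id_smoothingKernel hv0 has
  have hvar' : 0 < Var[fun x => x; P.map W] - (∫ x, x ∂(P.map W)) ^ 2 := by rwa [hva, hm]
  have hLle : 1 / s + 2 * |a| / v ≤ 2 / s + 4 * |a| / v := by gcongr <;> norm_num
  have hdK : ∀ β : ℝ, 0 < β → dK (P.map W) Z ≤ ENNReal.ofReal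
      ((1 / s + (1 / s + 2 * |a| / v)) * β + 2 * P.real {ω | β < |W ω - WA ω|}) :=
    fun β hβ => dK_le_add_measureReal hW hWA hid hL0 hL hK hβ
  have ha7 : 0 ≤ 7 * |a| / s := by positivity
  have hs14 : 0 ≤ 14 / s := by positivity
  -- The proved coefficients 2/s + 2|a|/v and 2 are at most 2/7 and 2/5 of the claimed ones; this is
  -- the slack spent in the moment bound.
  have hcoef : 1 / s + (1 / s + 2 * |a| / v) ≤ 2 / 7 * (14 / s + 7 * |a| / v) := by
    have e : 1 / s + (1 / s + 2 * |a| / v) = 2 / 7 * (14 / s / 2 + 7 * |a| / v) := by ring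
    linarith
  have hApos : 0 < 14 / s + 7 * |a| / v := by positivity
  refine ⟨fun β hβ => ⟨?_, ?_⟩, fun k hk hWk => ?_, fun hW3 => ?_, fun hW4 => ?_⟩
  · refine (hdK β hβ).trans (ENNReal.ofReal_le_ofReal ?_)
    have h1 : 1 / s + (1 / s + 2 * |a| / v) ≤ 14 / s + 7 * |a| / v := by linarith
    have h2 : 2 ≤ 5 + 7 * |a| / s := by linarith
    gcongr
  · refine dK_le_of_forall fun z =>
      (abs_measureReal_equilibrium_Iic_sub_le hW hWA hid hL0 hL hβ z).trans ?_
    refine add_le_add (by gcongr) (le_mul_of_one_le_left measureReal_nonneg ?_)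
    have : 0 ≤ 4 * |a| / s := by positivity
    linarith
  · obtain ⟨mW, mA⟩ := memLp_of_isAsymEquilibrium hW hWA hA hvar' (by linarith) hWk
    have hi := (mW.sub mA).integrable_norm_rpow (ENNReal.ofReal_pos.2 (by linarith)).ne'
      ENNReal.ofReal_ne_top
    rw [ENNReal.toReal_ofReal (by linarith)] at hi
    exact le_ofReal_rpow_of_forall_le hk hi hApos (by positivity) hcoef (by linarith) hdK
  · obtain ⟨mW, mA⟩ := memLp_of_isAsymEquilibrium hW hWA hA hvar' zero_lt_one (by
      refine hW3.congr (Filter.Eventually.of_forall fun ω => ?_)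
      have : (1 : ℝ) + 2 = (3 : ℕ) := by norm_num
      simp only [this, Real.rpow_natCast])
    rw [ENNReal.ofReal_one] at mW mA
    have hZ1 := hZ2.mono_exponent one_le_two
    have hq1 := hq2.mono_exponent one_le_two
    have h0 : 0 ≤ ∫ ω, |W ω - WA ω| ∂P := integral_nonneg fun ω => abs_nonneg _
    have hA1 := dW_equilibrium_le hW hWA hid hZ1 hq1 mW mA
    refine ⟨dW_le hW hWA hid hZ1 hq1 mW mA, hA1.trans (ENNReal.ofReal_le_ofReal ?_),
      hA1.trans (ENNReal.ofReal_le_ofReal ?_),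
      (dK_equilibrium_le_integral hW hWA hid hL
        (memLp_one_iff_integrable.1 (mW.sub mA))).trans (ENNReal.ofReal_le_ofReal ?_)⟩
    -- The estimate proved has constant 1, so both stated Wasserstein bounds for W^A follow from it.
    · refine le_mul_of_one_le_left h0 (le_add_of_nonneg_right (by positivity))
    · refine le_mul_of_one_le_left h0 (le_add_of_nonneg_right (by positivity))
    · gcongr
  · obtain ⟨-, mA⟩ := memLp_of_isAsymEquilibrium hW hWA hA hvar' two_pos (by
      refine hW4.congr (Filter.Eventually.of_forall fun ω => ?_)
      have : (2 : ℝ) + 2 = (4 : ℕ) := by norm_num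
      simp only [this, Real.rpow_natCast]
      rw [← abs_pow, abs_of_nonneg (by positivity)])
    rw [ENNReal.ofReal_ofNat] at mA
    refine (d2_le hW hWA hid hZ2 hq2 hW2 mA).trans_eq ?_
    rw [integral_abs_smoothingKernel hv0 has]
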